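/- **Setting.** Let $s\in\mathbb R$ and let $K_\varepsilon(x,y)$ ($x,y>0$, regulator $\varepsilon>0$) be a real integral kernel such that for every integer $k\ge 0$ and all sufficiently small $\varepsilon>0$ the following integral converges for all $x>0$ and satisfies $$\int_0^\infty dy\,K_\varepsilon(x,y)\,y^{-k\varepsilon}=x^{-(k+1)\varepsilon}\sum_{n\ge -1}f^{(k)}_n\,\varepsilon^n ,$$ with a convergent Laurent series on the right. The renormalized Dyson–Schwinger equation with invariant charge $Q(G)=G^s$ is $$G(\alpha,\varepsilon,x)=Z(\alpha,\varepsilon)+\alpha\int_0^\infty dy\,K_\varepsilon(x,y)\,G(\alpha,\varepsilon,y)^{s+1},$$ where $G$ and $Z=1+O(\alpha)$ are formal power series in $\alpha$, and the equation is understood order by order in $\alpha$, at each order for all sufficiently small $\varepsilon>0$ and all $x>0$. In *kinematic (MOM) renormalization* $Z$ is fixed by $G(\alpha,\varepsilon,1)=1$. In *Minimal Subtraction (MS)* every coefficient $[\alpha^n]Z$, $n\ge1$, is a polynomial in $1/\varepsilon$ without constant term, and $G$ has a limit as $\varepsilon\to0^+$. The invariant charge gives $Z_\alpha=Z^s$,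 and $$\beta(\alpha,\varepsilon)=\varepsilon-\frac{\varepsilon}{\alpha\,\partial_\alpha\ln(\alpha Z_\alpha)},\qquad \gamma(\alpha,\varepsilon)=(\varepsilon-\beta(\alpha,\varepsilon))\,\alpha\,\partial_\alpha\ln Z .$$ The perturbative solution $G(\alpha,x)$ and its anomalous dimension $\gamma(\alpha)$ are the coefficientwise limits of $G(\alpha,\varepsilon,x)$ and $\gamma(\alpha,\varepsilon)$ as $\varepsilon\to0^+$ (the theory is assumed to be multiplicatively renormalizable, that is, these limits exist). MS quantities carry a hat. For a formal power series $a(\alpha)$ and a smooth function $h$, $h(a(\alpha))$ denotes the Taylor series of $h$ at $a(0)$ composed with $a(\alpha)-a(0)$, and $G(\alpha,a(\alpha))=\sum_n\alpha^nG_n(a(\alpha))$ for $G(\alpha,x)=\sum_n\alpha^nG_n(x)$. **Theorem.** Let $G(\alpha,x)$ and $\hat G(\alpha,x)$ be the perturbative solutions of the same Dyson–Schwinger equation as above, $G$ in MOM and $\hat G$ in MS renormalization, and assume that the anomalous dimensions $\gamma(\alpha)$ and $\hat\gamma(\alpha)$ both have a non-zero term linear in $\alpha$. Then there is a unique formal power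 series $\delta(\alpha)$ with real coefficients and $\delta(0)>0$ such that, as formal power series in $\alpha$, $$G(\alpha,\delta(\alpha)\,x)=\hat G(\alpha,x)\qquad\text{for all }x>0 .$$ Moreover $f^{(0)}_{-1}\ne0$ and $$\ln\delta(0)=-\frac{f^{(0)}_0}{f^{(0)}_{-1}} .$$ If $s\neq0$, then $$\frac{\partial}{\partial\alpha}\ln\delta(\alpha)=\frac1{s\alpha}\left(\frac1{\hat\gamma(\alpha)}-\frac1{\gamma(\alpha)}\right)=\frac{\gamma(\alpha)-\hat\gamma(\alpha)}{s\,\alpha\,\hat\gamma(\alpha)\,\gamma(\alpha)} ,$$ as an identity of formal Laurent series. If $s=0$, then $\hat\gamma=\gamma$ and $\gamma(\alpha)\ln\delta(\alpha)=\ln\hat G(\alpha,1)$. -/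

import Mathlib

open PowerSeries Filter Topology MeasureTheory Set
open scoped Nat LaurentSeries

/-! Power series are in the coupling `α` (the variable `X`).  Regularised quantities also depend on
the regulator `ε`, which tends to `0` from the right, and on the momentum variable `x > 0`. -/

noncomputable section

namespace DysonSchwinger

/-- The formal power series `f(a(α))`: the Taylor series of `f` at `a(0)`, with `a(α) - a(0)`
substituted for the variable. -/
def comp (f : ℝ → ℝ) (a : ℝ⟦X⟧) : ℝ⟦X⟧ :=
  (PowerSeries.mk fun k => iteratedDeriv k f (constantCoeff a) / (k ! : ℝ)).subst
    (a - C (constantCoeff a))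

/-- `G(α, a(α))` for `G(α, x) = ∑ₙ αⁿ Gₙ(x)`: the formal power series `∑ₙ αⁿ Gₙ(a(α))`. -/
def evalAt (G : ℝ → ℝ⟦X⟧) (a : ℝ⟦X⟧) : ℝ⟦X⟧ :=
  PowerSeries.mk fun N => ∑ n ∈ Finset.range (N + 1),
    coeff (N - n) (comp (fun x => coeff n (G x)) a)

/-- The primitive integral with the insertion `y ^ (-kε)`, at `x = 1`. -/
def amplitude (K : ℝ → ℝ → ℝ → ℝ) (k : ℕ) (ε : ℝ) : ℝ :=
  ∫ y in Ioi 0, K ε 1 y * y ^ (-(k * ε))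

/-- `K ε x y` is the dimensionally regularised kernel of a propagator-type Dyson-Schwinger
equation: the primitive integrals converge for small `ε > 0`, depend on the only scale `x` through
the power `x ^ (-(k + 1)ε)`, and have a Laurent expansion `∑_{n ≥ -1} f k n * ε ^ n`. -/
structure IsPropagatorKernel (K : ℝ → ℝ → ℝ → ℝ) (f : ℕ → ℤ → ℝ) : Prop where
  integrable : ∀ k : ℕ, ∀ᶠ ε in 𝓝[>] (0 : ℝ), ∀ x > 0,
    IntegrableOn (fun y => K ε x y * y ^ (-(k * ε))) (Ioi 0)
  scaling : ∀ k : ℕ, ∀ᶠ ε in 𝓝[>] (0 : ℝ), ∀ x > 0,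
    ∫ y in Ioi 0, K ε x y * y ^ (-(k * ε)) = amplitude K k ε * x ^ (-((k + 1) * ε))
  laurent : ∀ k : ℕ, ∀ᶠ ε in 𝓝[>] (0 : ℝ),
    HasSum (fun m : ℕ => f k ((m : ℤ) - 1) * ε ^ ((m : ℤ) - 1)) (amplitude K k ε)

/-- `G(α, ε, x)` solves, order by order in `α`, the equation
`G = Z + α ∫ dy K(x, y) Q(G(y)) G(y)` with invariant charge `Q(G) = G ^ s` and with a counter
term `Z(α, ε) = 1 + O(α)`. -/
structure SolvesDSE (K : ℝ → ℝ → ℝ → ℝ) (s : ℝ) (Z : ℝ → ℝ⟦X⟧) (G : ℝ → ℝ → ℝ⟦X⟧) : Prop where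
  counterterm_zero : ∀ᶠ ε in 𝓝[>] (0 : ℝ), coeff 0 (Z ε) = 1
  order_zero : ∀ᶠ ε in 𝓝[>] (0 : ℝ), ∀ x > 0, coeff 0 (G ε x) = coeff 0 (Z ε)
  order_succ : ∀ n : ℕ, ∀ᶠ ε in 𝓝[>] (0 : ℝ), ∀ x > 0,
    coeff (n + 1) (G ε x) = coeff (n + 1) (Z ε) +
      ∫ y in Ioi 0, K ε x y * coeff n (comp (fun t => t ^ (s + 1)) (G ε y))

/-- Kinematic renormalization condition: `G(α, ε, 1) = 1`. -/
def MOMCondition (G : ℝ → ℝ → ℝ⟦X⟧) : Prop :=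
  ∀ n : ℕ, ∀ᶠ ε in 𝓝[>] (0 : ℝ), coeff n (G ε 1) = coeff n (1 : ℝ⟦X⟧)

/-- Minimal Subtraction: at every order in `α`, the counter term consists of finitely many pole
terms in `ε` only. -/
def MSCondition (Z : ℝ → ℝ⟦X⟧) : Prop :=
  ∀ n : ℕ, 1 ≤ n → ∃ p : Polynomial ℝ, p.coeff 0 = 0 ∧
    ∀ᶠ ε in 𝓝[>] (0 : ℝ), coeff n (Z ε) = p.eval ε⁻¹

/-- `α ∂_α ln Z`. -/
def eulerLog (z : ℝ⟦X⟧) : ℝ⟦X⟧ := X * d⁄dX ℝ z * z⁻¹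

/-- The beta function `β(α, ε) = ε - ε / (α ∂_α ln (α Z_α))`, where `Z_α = Z ^ s`. -/
def betaReg (s ε : ℝ) (z : ℝ⟦X⟧) : ℝ⟦X⟧ := C ε - C ε * (1 + C s * eulerLog z)⁻¹

/-- The anomalous dimension `γ(α, ε) = (ε - β(α, ε)) α ∂_α ln Z`.  The sign is the one for which
`x ∂_x G = (γ + (β - ε) α ∂_α) G`, and `β = s γ`. -/
def gammaReg (s ε : ℝ) (z : ℝ⟦X⟧) : ℝ⟦X⟧ := (C ε - betaReg s ε z) * eulerLog z

/-- `G(α, x)` and `γ(α)` are the limits, as `ε → 0⁺`, of the renormalized Green function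
`Gr(α, ε, x)` and of the anomalous dimension derived from the counter term `Z(α, ε)`. -/
structure IsPhysicalLimit (s : ℝ) (Z : ℝ → ℝ⟦X⟧) (Gr : ℝ → ℝ → ℝ⟦X⟧)
    (G : ℝ → ℝ⟦X⟧) (γ : ℝ⟦X⟧) : Prop where
  green : ∀ n : ℕ, ∀ x > 0,
    Tendsto (fun ε => coeff n (Gr ε x)) (𝓝[>] 0) (𝓝 (coeff n (G x)))
  anomalous : ∀ n : ℕ,
    Tendsto (fun ε => coeff n (gammaReg s ε (Z ε))) (𝓝[>] 0) (𝓝 (coeff n γ))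

/-- `G(α, x)` is the perturbative solution in kinematic renormalization at `x = 1`, and `γ(α)` is
its anomalous dimension. -/
def IsMOMSolution (K : ℝ → ℝ → ℝ → ℝ) (s : ℝ) (G : ℝ → ℝ⟦X⟧) (γ : ℝ⟦X⟧) : Prop :=
  ∃ (Z : ℝ → ℝ⟦X⟧) (Gr : ℝ → ℝ → ℝ⟦X⟧),
    SolvesDSE K s Z Gr ∧ MOMCondition Gr ∧ IsPhysicalLimit s Z Gr G γ

/-- `G(α, x)` is the perturbative solution in Minimal Subtraction, and `γ(α)` is its anomalous
dimension. -/
def IsMSSolution (K : ℝ → ℝ → ℝ → ℝ) (s : ℝ) (G : ℝ → ℝ⟦X⟧) (γ : ℝ⟦X⟧) : Prop :=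
  ∃ (Z : ℝ → ℝ⟦X⟧) (Gr : ℝ → ℝ → ℝ⟦X⟧),
    SolvesDSE K s Z Gr ∧ MSCondition Z ∧ IsPhysicalLimit s Z Gr G γ

/-- `δ(α)`, with `δ(0) > 0`, satisfies `G(α, δ(α) x) = Gh(α, x)` for all `x > 0`. -/
def IsShift (G Gh : ℝ → ℝ⟦X⟧) (δ : ℝ⟦X⟧) : Prop :=
  0 < constantCoeff δ ∧ ∀ x > 0, evalAt G (C x * δ) = Gh x

end DysonSchwinger

end

/-!
The comparison of the two schemes rests on the operation `run s p a = a(α) p(α a(α) ^ s)` on formal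
power series with constant coefficient `1`. It is associative (`run_run`), commutes with rescaling
of `α` (`rescale_run`), and every equation `run s p h = q` is solvable for `h` (`exists_run_eq`).

By the scaling of the primitive integrals, a solution of the regularized equation with counterterm
`Z` is, order by order and for small `ε`, the series `run s (F(x ^ (-ε) α)) Z`, where the bare
series `F` does not depend on the scheme (`SolvesDSE.coeff_eq_regSolution`). Two solutions
therefore differ by the action of one series `h`, which the kinematic condition at `x = 1`
identifies. The limit `ε → 0⁺` gives the evolution law `Gh(α, x y) = run s G(α, x) Gh(α, y)` for
`G` in kinematic renormalization and every solution `Gh` (`green_mul_eq_run`).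

A function of `x` that is for every `ε` a polynomial of bounded degree in `x ^ (-ε)` and converges
as `ε → 0⁺` has a polynomial in `log x` as its limit, together with its logarithmic derivative
(`exists_polynomial_log_of_tendsto`). So the Green functions are power series over `ℝ[L]`,
`L = log x`, and the renormalization group equation of the regularized theory
(`run_renormalizationGroup`) becomes `∂G/∂L = γ G + s γ α ∂G/∂α`
(`IsPhysicalLimit.exists_log_expansion`). A formal logarithm `ℓ(α)` may then be inserted for `L`
(`evalSeries`), and all polynomial identities in `L` persist (`evalSeries_eq_run`).

Since `G = 1 + γ₁ α L + O(α ^ 2)` with `γ₁ ≠ 0`, the equation `G(α, ℓ(α)) = Gh(α, 1)` has a unique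
solution `ℓ = ln δ` (`existsUnique_evalSeries_eq`), and the evolution law extends it to all momenta.
Comparison of the renormalization group equations of `G` and of `Gh` at this point gives
`s α ℓ' γ γh = γ - γh` (`anomalous_dimension_relation`). For `s = 0` one has `G = exp(γ L)`. The
value of `δ(0)` comes from the first order, where `γ₁ = - f 0 (-1)` and the poles cancel in
`coeff 1 (Gh 1) = f 0 0`.
-/

namespace DysonSchwinger

/-! ### Coefficients of substitutions -/

lemma hasSubst_X_mul {R : Type*} [CommRing R] (b : R⟦X⟧) : HasSubst (X * b : R⟦X⟧) :=
  HasSubst.of_constantCoeff_zero' (by simp)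

lemma hasSubst_sub_C (a : ℝ⟦X⟧) : HasSubst (a - C (constantCoeff a) : ℝ⟦X⟧) :=
  HasSubst.of_constantCoeff_zero' (by simp)

lemma coeff_pow_eq_zero_of_lt {R : Type*} [CommRing R] {u : R⟦X⟧} (hu : constantCoeff u = 0)
    {n k : ℕ} (h : n < k) : coeff n (u ^ k) = 0 := by
  have h1 : (X : R⟦X⟧) ^ k ∣ u ^ k := pow_dvd_pow_of_dvd (X_dvd_iff.2 hu) k
  exact X_pow_dvd_iff.1 h1 n h

lemma coeff_subst_eq_sum {u : ℝ⟦X⟧} (hu : constantCoeff u = 0) (p : ℝ⟦X⟧) {n N : ℕ}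
    (h : n < N) :
    coeff n (p.subst u) = ∑ k ∈ Finset.range N, coeff k p * coeff n (u ^ k) := by
  rw [coeff_subst' (HasSubst.of_constantCoeff_zero' hu)]
  simp only [smul_eq_mul]
  refine finsum_eq_sum_of_support_subset _ fun k hk => ?_
  by_contra hk'
  simp only [Finset.coe_range, mem_Iio, not_lt] at hk'
  exact hk (by simp only [coeff_pow_eq_zero_of_lt hu (lt_of_lt_of_le h hk'), mul_zero])

lemma coeff_mul_subst_X_mul (a p b : ℝ⟦X⟧) (n : ℕ) :
    coeff n (a * p.subst (X * b : ℝ⟦X⟧)) =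
      ∑ k ∈ Finset.range (n + 1), coeff k p * coeff (n - k) (a * b ^ k) := by
  have h1 : coeff n (a * p.subst (X * b : ℝ⟦X⟧)) =
      coeff n (a * ∑ k ∈ Finset.range (n + 1), C (coeff k p) * (X * b) ^ k) := by
    rw [coeff_mul, coeff_mul]
    refine Finset.sum_congr rfl fun ij hij => ?_
    have : ij.2 < n + 1 := by have := Finset.HasAntidiagonal.mem_antidiagonal.1 hij; omega
    rw [coeff_subst_eq_sum (by simp) p this, map_sum]
    simp only [coeff_C_mul]
  rw [h1, Finset.mul_sum, map_sum]
  refine Finset.sum_congr rfl fun k hk => ?_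
  have hk' : k ≤ n := Nat.lt_succ_iff.1 (Finset.mem_range.1 hk)
  obtain ⟨m, rfl⟩ := Nat.exists_eq_add_of_le hk'
  rw [show a * (C (coeff k p) * (X * b) ^ k) = C (coeff k p) * (X ^ k * (a * b ^ k)) by ring,
    coeff_C_mul, add_comm k m, coeff_X_pow_mul, Nat.add_sub_cancel]

lemma constantCoeff_subst_of_zero {u : ℝ⟦X⟧} (hu : constantCoeff u = 0) (p : ℝ⟦X⟧) :
    constantCoeff (p.subst u : ℝ⟦X⟧) = constantCoeff p := by
  rw [← coeff_zero_eq_constantCoeff_apply, coeff_subst_eq_sum hu p zero_lt_one]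
  simp

lemma subst_subst_of_zero {u v : ℝ⟦X⟧} (hu : constantCoeff u = 0) (hv : constantCoeff v = 0)
    (p : ℝ⟦X⟧) :
    PowerSeries.subst v (PowerSeries.subst u p : ℝ⟦X⟧) =
      (PowerSeries.subst (PowerSeries.subst v u : ℝ⟦X⟧) p : ℝ⟦X⟧) :=
  subst_comp_subst_apply (HasSubst.of_constantCoeff_zero' hu)
    (HasSubst.of_constantCoeff_zero' hv) p

/-! ### Taylor composition -/

/-- The Taylor series of `f` at `x`. -/
noncomputable def taylorSeries (f : ℝ → ℝ) (x : ℝ) : ℝ⟦X⟧ :=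
  PowerSeries.mk fun k => iteratedDeriv k f x / (k ! : ℝ)

lemma comp_eq_subst (f : ℝ → ℝ) (a : ℝ⟦X⟧) :
    comp f a = (taylorSeries f (constantCoeff a)).subst (a - C (constantCoeff a)) := rfl

@[simp]
lemma constantCoeff_comp (f : ℝ → ℝ) (a : ℝ⟦X⟧) :
    constantCoeff (comp f a) = f (constantCoeff a) := by
  rw [comp_eq_subst, constantCoeff_subst_of_zero (by simp)]
  rw [← coeff_zero_eq_constantCoeff_apply]
  simp [taylorSeries]

lemma comp_congr {f g : ℝ → ℝ} {a : ℝ⟦X⟧} (h : f =ᶠ[𝓝 (constantCoeff a)] g) :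
    comp f a = comp g a := by
  unfold comp
  simp only [h.iteratedDeriv_eq]

lemma derivative_taylorSeries (f : ℝ → ℝ) (x : ℝ) :
    d⁄dX ℝ (taylorSeries f x) = taylorSeries (deriv f) x := by
  ext n
  simp only [taylorSeries, coeff_derivative, coeff_mk, iteratedDeriv_succ', Nat.factorial_succ]
  push_cast
  field_simp

/-- The chain rule. -/
lemma derivative_comp (f : ℝ → ℝ) (a : ℝ⟦X⟧) :
    d⁄dX ℝ (comp f a) = comp (deriv f) a * d⁄dX ℝ a := by
  rw [comp_eq_subst, derivative_subst (hasSubst_sub_C a), derivative_taylorSeries, map_sub,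
    derivative_C, sub_zero, comp_eq_subst]

lemma taylorSeries_mul {f g : ℝ → ℝ} {x : ℝ} (hf : ContDiffAt ℝ ⊤ f x)
    (hg : ContDiffAt ℝ ⊤ g x) :
    taylorSeries (fun t => f t * g t) x = taylorSeries f x * taylorSeries g x := by
  ext n
  rw [coeff_mul]
  simp only [taylorSeries, coeff_mk]
  have := iteratedDeriv_fun_mul (n := n) (hf.of_le le_top) (hg.of_le le_top)
  rw [this, Finset.sum_div, Finset.Nat.sum_antidiagonal_eq_sum_range_succ_mk]
  refine Finset.sum_congr rfl fun k hk => ?_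
  have hk' : k ≤ n := Nat.lt_succ_iff.1 (Finset.mem_range.1 hk)
  have h2 := Nat.choose_mul_factorial_mul_factorial hk'
  have h3 : ((n.choose k : ℝ)) * (k ! : ℝ) * ((n - k)! : ℝ) = n ! := by exact_mod_cast h2
  have : (n ! : ℝ) ≠ 0 := by positivity
  rw [← h3] at this ⊢
  have : ((n.choose k : ℝ)) ≠ 0 := by
    have := Nat.choose_pos hk'; positivity
  field_simp

lemma comp_mul {f g : ℝ → ℝ} {a : ℝ⟦X⟧} (hf : ContDiffAt ℝ ⊤ f (constantCoeff a))
    (hg : ContDiffAt ℝ ⊤ g (constantCoeff a)) :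
    comp (fun t => f t * g t) a = comp f a * comp g a := by
  simp only [comp_eq_subst, taylorSeries_mul hf hg, subst_mul (hasSubst_sub_C a)]

lemma comp_add {f g : ℝ → ℝ} {a : ℝ⟦X⟧} (hf : ContDiffAt ℝ ⊤ f (constantCoeff a))
    (hg : ContDiffAt ℝ ⊤ g (constantCoeff a)) :
    comp (fun t => f t + g t) a = comp f a + comp g a := by
  have : taylorSeries (fun t => f t + g t) (constantCoeff a) =
      taylorSeries f (constantCoeff a) + taylorSeries g (constantCoeff a) := by
    ext n
    simp only [taylorSeries, coeff_mk, map_add]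
    rw [iteratedDeriv_fun_add (hf.of_le le_top) (hg.of_le le_top), add_div]
  simp only [comp_eq_subst, this, subst_add (hasSubst_sub_C a)]

lemma comp_const (c : ℝ) (a : ℝ⟦X⟧) : comp (fun _ => c) a = C c := by
  refine derivative.ext ?_ ?_
  · rw [derivative_comp, derivative_C, deriv_const', comp]
    have : (PowerSeries.mk fun k =>
        iteratedDeriv k (fun _ : ℝ => (0 : ℝ)) (constantCoeff a) / (k ! : ℝ)) = 0 := by
      ext k
      simp
    rw [this, ← coe_substAlgHom (hasSubst_sub_C a), map_zero, zero_mul]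
  · simp

lemma comp_id (a : ℝ⟦X⟧) : comp (fun t => t) a = a := by
  refine derivative.ext ?_ ?_
  · rw [derivative_comp, deriv_id'', comp_const, map_one, one_mul]
  · simp

lemma comp_const_mul (c : ℝ) (f : ℝ → ℝ) (a : ℝ⟦X⟧) :
    comp (fun t => c * f t) a = C c * comp f a := by
  have : taylorSeries (fun t => c * f t) (constantCoeff a) =
      c • taylorSeries f (constantCoeff a) := by
    ext n
    simp only [taylorSeries, coeff_mk, coeff_smul, smul_eq_mul]
    rw [iteratedDeriv_const_mul_field, mul_div_assoc]
  rw [comp_eq_subst, this, subst_smul (hasSubst_sub_C a), comp_eq_subst, smul_eq_C_mul]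

/-- The coefficients of `f(a(α))` up to order `n` involve finitely many Taylor coefficients. -/
lemma coeff_comp (f : ℝ → ℝ) (a : ℝ⟦X⟧) {n N : ℕ} (h : n < N) :
    coeff n (comp f a) = ∑ k ∈ Finset.range N,
      coeff k (taylorSeries f (constantCoeff a)) * coeff n ((a - C (constantCoeff a)) ^ k) := by
  rw [comp_eq_subst, coeff_subst_eq_sum (by simp) _ h]

lemma coeff_pow_congr {a b : ℝ⟦X⟧} {n : ℕ} (h : ∀ m ≤ n, coeff m a = coeff m b) (k : ℕ) :
    ∀ m ≤ n, coeff m (a ^ k) = coeff m (b ^ k) := by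
  have h1 : (X : ℝ⟦X⟧) ^ (n + 1) ∣ a - b :=
    X_pow_dvd_iff.2 fun m hm => by rw [map_sub, h m (by omega), sub_self]
  intro m hm
  have := X_pow_dvd_iff.1 (h1.trans (sub_dvd_pow_sub_pow a b k)) m (by omega)
  rwa [map_sub, sub_eq_zero] at this

lemma coeff_comp_congr (f : ℝ → ℝ) {a b : ℝ⟦X⟧} {n : ℕ}
    (h : ∀ m ≤ n, coeff m a = coeff m b) : coeff n (comp f a) = coeff n (comp f b) := by
  have h0 : constantCoeff a = constantCoeff b := by simpa using h 0 (Nat.zero_le n)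
  rw [coeff_comp f a (Nat.lt_succ_self n), coeff_comp f b (Nat.lt_succ_self n), h0]
  refine Finset.sum_congr rfl fun k _ => ?_
  congr 1
  exact coeff_pow_congr (fun m hm => by rw [map_sub, map_sub, h m hm]) k n le_rfl

/-! ### Formal real powers -/

/-- The real power `a(α) ^ p` of a formal power series. -/
noncomputable def fpow (a : ℝ⟦X⟧) (p : ℝ) : ℝ⟦X⟧ := comp (fun t => t ^ p) a

lemma constantCoeff_fpow {a : ℝ⟦X⟧} (ha : constantCoeff a = 1) (p : ℝ) :
    constantCoeff (fpow a p) = 1 := by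
  rw [fpow, constantCoeff_comp, ha, Real.one_rpow]

lemma mul_derivative_fpow {a : ℝ⟦X⟧} (ha : constantCoeff a = 1) (p : ℝ) :
    a * d⁄dX ℝ (fpow a p) = C p * fpow a p * d⁄dX ℝ a := by
  have h0 : constantCoeff a ≠ 0 := by rw [ha]; exact one_ne_zero
  have h1 : a * comp (fun t => t ^ (p - 1)) a = fpow a p := by
    have : a * comp (fun t => t ^ (p - 1)) a =
        comp (fun t => t) a * comp (fun t => t ^ (p - 1)) a := by rw [comp_id]
    rw [this, ← comp_mul contDiffAt_fun_id (Real.contDiffAt_rpow_const_of_ne h0)]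
    refine comp_congr ?_
    filter_upwards [eventually_ne_nhds h0] with t ht
    rw [Real.rpow_sub_one ht, mul_div_cancel₀ _ ht]
  unfold fpow at h1 ⊢
  rw [derivative_comp, Real.deriv_rpow_const', comp_const_mul, ← h1]
  ring

/-- The equation `a b' = p b a'` determines `b` from its constant coefficient. -/
lemma eq_of_mul_derivative_eq {a b c : ℝ⟦X⟧} {p : ℝ} (ha : constantCoeff a ≠ 0)
    (hb0 : constantCoeff b ≠ 0) (hbc : constantCoeff b = constantCoeff c)
    (hb : a * d⁄dX ℝ b = C p * b * d⁄dX ℝ a) (hc : a * d⁄dX ℝ c = C p * c * d⁄dX ℝ a) :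
    b = c := by
  have ha' : a ≠ 0 := fun h => ha (by rw [h, map_zero])
  have hbb : b * b⁻¹ = 1 := PowerSeries.mul_inv_cancel b hb0
  have h1 : c * b⁻¹ = 1 := by
    refine derivative.ext ?_ ?_
    · refine mul_left_cancel₀ ha' ?_
      simp only [Derivation.leibniz, derivative_inv', smul_eq_mul, derivative_one]
      linear_combination b⁻¹ * hc - c * b⁻¹ ^ 2 * hb -
        (C p * c * d⁄dX ℝ a * b⁻¹) * hbb
    · rw [map_mul, ← hbc, ← map_mul, hbb]
  calc b = (c * b⁻¹) * b := by rw [h1, one_mul]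
    _ = c * (b * b⁻¹) := by ring
    _ = c := by rw [hbb, mul_one]

lemma fpow_unique {a b : ℝ⟦X⟧} {p : ℝ} (ha : constantCoeff a = 1) (hb : constantCoeff b = 1)
    (h : a * d⁄dX ℝ b = C p * b * d⁄dX ℝ a) : b = fpow a p :=
  eq_of_mul_derivative_eq (by rw [ha]; exact one_ne_zero) (by rw [hb]; exact one_ne_zero)
    (by rw [hb, constantCoeff_fpow ha]) h (mul_derivative_fpow ha p)

lemma mul_fpow {a b : ℝ⟦X⟧} (ha : constantCoeff a = 1) (hb : constantCoeff b = 1) (p : ℝ) :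
    fpow (a * b) p = fpow a p * fpow b p := by
  refine (fpow_unique (by simp [ha, hb])
    (by simp [constantCoeff_fpow ha, constantCoeff_fpow hb]) ?_).symm
  have h1 := mul_derivative_fpow ha p
  have h2 := mul_derivative_fpow hb p
  simp only [Derivation.leibniz, smul_eq_mul]
  linear_combination (b * fpow b p) * h1 + (a * fpow a p) * h2

lemma fpow_add_one {a : ℝ⟦X⟧} (ha : constantCoeff a = 1) (p : ℝ) :
    fpow a (p + 1) = a * fpow a p := by
  refine (fpow_unique ha (by simp [ha, constantCoeff_fpow ha]) ?_).symm
  have h1 := mul_derivative_fpow ha p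
  simp only [Derivation.leibniz, smul_eq_mul, map_add, map_one]
  linear_combination a * h1

lemma fpow_subst {a u : ℝ⟦X⟧} (ha : constantCoeff a = 1) (hu : constantCoeff u = 0) (p : ℝ) :
    fpow (a.subst u) p = (fpow a p).subst u := by
  have hs : HasSubst u := HasSubst.of_constantCoeff_zero' hu
  refine (fpow_unique (by rw [constantCoeff_subst_of_zero hu, ha])
    (by rw [constantCoeff_subst_of_zero hu, constantCoeff_fpow ha]) ?_).symm
  have h1 := congrArg (fun q : ℝ⟦X⟧ => (q.subst u : ℝ⟦X⟧)) (mul_derivative_fpow ha p)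
  simp only [subst_mul hs] at h1
  rw [show (C p : ℝ⟦X⟧).subst u = (C p : ℝ⟦X⟧) from subst_C (a := u) p] at h1
  rw [derivative_subst hs, derivative_subst hs]
  linear_combination d⁄dX ℝ u * h1

lemma rescale_eq_subst_X_mul (c : ℝ) (a : ℝ⟦X⟧) :
    rescale c a = a.subst (X * C c : ℝ⟦X⟧) := by
  rw [rescale_eq_subst, smul_eq_C_mul, mul_comm]

lemma fpow_rescale {a : ℝ⟦X⟧} (ha : constantCoeff a = 1) (c p : ℝ) :
    fpow (rescale c a) p = rescale c (fpow a p) := by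
  rw [rescale_eq_subst_X_mul, rescale_eq_subst_X_mul, fpow_subst ha (by simp)]

@[simp]
lemma constantCoeff_rescale (c : ℝ) (a : ℝ⟦X⟧) :
    constantCoeff (rescale c a) = constantCoeff a := by
  rw [← coeff_zero_eq_constantCoeff_apply, coeff_rescale]
  simp

/-! ### Causal equations -/

lemma X_pow_dvd_sub_iff {R : Type*} [CommRing R] {a b : R⟦X⟧} {n : ℕ} :
    X ^ n ∣ a - b ↔ ∀ m < n, coeff m a = coeff m b := by
  simp only [X_pow_dvd_iff, map_sub, sub_eq_zero]

lemma dvd_mul_sub_mul_of_dvd {R : Type*} [CommRing R] {d a b a' b' : R} (h : d ∣ a - a')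
    (h' : d ∣ b - b') : d ∣ a * b - a' * b' := by
  rw [show a * b - a' * b' = a * (b - b') + (a - a') * b' by ring]
  exact dvd_add (h'.mul_left a) (h.mul_right b')

lemma dvd_fpow_sub_fpow {a b : ℝ⟦X⟧} {n : ℕ} (h : X ^ n ∣ a - b) (p : ℝ) :
    X ^ n ∣ fpow a p - fpow b p := by
  rw [X_pow_dvd_sub_iff] at h ⊢
  exact fun m hm => coeff_comp_congr _ fun k hk => h k (lt_of_le_of_lt hk hm)

/-- An operator whose `n`-th output coefficient depends only on the input coefficients of lower
order has a fixed point. -/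
lemma exists_fixedPoint_of_causal (T : ℝ⟦X⟧ → ℝ⟦X⟧)
    (hT : ∀ n a b, X ^ n ∣ a - b → coeff n (T a) = coeff n (T b)) : ∃ a, T a = a := by
  have key : ∀ n, ∀ N, n < N → coeff n (T^[N] 0) = coeff n (T^[n + 1] 0) := by
    intro n
    induction n using Nat.strong_induction_on with
    | _ n ih =>
      intro N hN
      obtain ⟨M, rfl⟩ : ∃ M, N = M + 1 := ⟨N - 1, by omega⟩
      rw [Function.iterate_succ_apply', Function.iterate_succ_apply']
      refine hT n _ _ (X_pow_dvd_sub_iff.2 fun m hm => ?_)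
      rw [ih m hm M (by omega), ih m hm n hm]
  refine ⟨PowerSeries.mk fun n => coeff n (T^[n + 1] 0), ?_⟩
  ext n
  rw [coeff_mk, Function.iterate_succ_apply']
  refine hT n _ _ (X_pow_dvd_sub_iff.2 fun m hm => ?_)
  rw [coeff_mk, key m n hm]

/-! ### The action of the running coupling -/

/-- `a(α) p(α a(α) ^ s)`: the series `p` at the effective coupling `α a ^ s`, multiplied by `a`.
A solution with counterterm `Z` is `run s F Z`, where `F` is the bare series. -/
noncomputable def run (s : ℝ) (p a : ℝ⟦X⟧) : ℝ⟦X⟧ := a * p.subst (X * fpow a s : ℝ⟦X⟧)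

section

variable {s : ℝ} {p q a : ℝ⟦X⟧}

lemma coeff_run (s : ℝ) (p a : ℝ⟦X⟧) (n : ℕ) :
    coeff n (run s p a) =
      ∑ k ∈ Finset.range (n + 1), coeff k p * coeff (n - k) (a * fpow a s ^ k) :=
  coeff_mul_subst_X_mul a p _ n

lemma constantCoeff_run (s : ℝ) (p a : ℝ⟦X⟧) :
    constantCoeff (run s p a) = constantCoeff a * constantCoeff p := by
  rw [run, map_mul, constantCoeff_subst_of_zero (by simp)]

lemma one_run (s : ℝ) (a : ℝ⟦X⟧) : run s 1 a = a := by
  rw [run, ← coe_substAlgHom (hasSubst_X_mul _), map_one, mul_one]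

lemma fpow_run (ha : constantCoeff a = 1) (hp : constantCoeff p = 1) (r : ℝ) :
    fpow (run s p a) r = fpow a r * (fpow p r).subst (X * fpow a s : ℝ⟦X⟧) := by
  rw [run, mul_fpow ha (by rw [constantCoeff_subst_of_zero (by simp), hp]),
    fpow_subst hp (by simp)]

/-- The action is associative: the effective coupling `α (run s q a) ^ s` is `α q(α) ^ s` at the
effective coupling `α a ^ s`. -/
lemma run_run (ha : constantCoeff a = 1) (hq : constantCoeff q = 1) (p : ℝ⟦X⟧) :
    run s p (run s q a) = run s (run s p q) a := by
  have hs := hasSubst_X_mul (fpow a s)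
  have h1 : PowerSeries.subst (X * fpow a s : ℝ⟦X⟧) (run s p q) =
      (PowerSeries.subst (X * fpow a s : ℝ⟦X⟧) q : ℝ⟦X⟧) *
        PowerSeries.subst (X * fpow a s * (fpow q s).subst (X * fpow a s : ℝ⟦X⟧) : ℝ⟦X⟧) p := by
    rw [run, subst_mul hs, subst_subst_of_zero (by simp) (by simp), subst_mul hs, subst_X hs]
  rw [run, fpow_run ha hq]
  conv_rhs => rw [run, h1]
  rw [run]
  rw [mul_assoc, mul_assoc X]

lemma rescale_run (ha : constantCoeff a = 1) (c : ℝ) :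
    rescale c (run s p a) = run s (rescale c p) (rescale c a) := by
  have hs := hasSubst_X_mul (C c : ℝ⟦X⟧)
  rw [run, map_mul, run, fpow_rescale ha]
  congr 1
  rw [rescale_eq_subst_X_mul, subst_subst_of_zero (by simp) (by simp), subst_mul hs, subst_X hs,
    rescale_eq_subst_X_mul c p, subst_subst_of_zero (by simp) (by simp),
    subst_mul (hasSubst_X_mul _), subst_X (hasSubst_X_mul _), rescale_eq_subst_X_mul]
  congr 1
  rw [show ((C c : ℝ⟦X⟧).subst (X * PowerSeries.subst (X * C c : ℝ⟦X⟧) (fpow a s) : ℝ⟦X⟧)) =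
    (C c : ℝ⟦X⟧) from subst_C c]
  ring

/-- Under `run s`, series with constant coefficient `1` form a group: the equation `run s p h = q`
is solvable for `h`. -/
lemma exists_run_eq (s : ℝ) (hp : constantCoeff p = 1) (hq : constantCoeff q = 1) :
    ∃ h, constantCoeff h = 1 ∧ run s p h = q := by
  obtain ⟨h, hh⟩ := exists_fixedPoint_of_causal (fun h => q - (run s p h - h)) (by
    intro n a b hab
    have : ∀ h, coeff n (run s p h - h) =
        ∑ k ∈ Finset.range n, coeff (k + 1) p * coeff (n - (k + 1)) (h * fpow h s ^ (k + 1)) := by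
      intro h
      rw [map_sub, coeff_run, Finset.sum_range_succ']
      simp [hp]
    rw [map_sub (coeff n) q, map_sub (coeff n) q, this, this]
    congr 1
    refine Finset.sum_congr rfl fun k hk => ?_
    congr 1
    exact X_pow_dvd_sub_iff.1 (dvd_mul_sub_mul_of_dvd hab
      ((dvd_fpow_sub_fpow hab s).trans (sub_dvd_pow_sub_pow _ _ _))) _
        (by have := Finset.mem_range.1 hk; omega))
  have h2 : run s p h = q := by linear_combination -hh
  refine ⟨h, ?_, h2⟩
  have h3 := congrArg constantCoeff h2
  rwa [constantCoeff_run, hp, hq, mul_one] at h3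

/-- The bare series of a Dyson-Schwinger equation whose primitive integrals take the values
`A k`. -/
lemma exists_bareSeries (s : ℝ) (A : ℕ → ℝ) :
    ∃ F : ℝ⟦X⟧, constantCoeff F = 1 ∧
      ∀ n, coeff (n + 1) F = A n * coeff n (fpow F (s + 1)) := by
  obtain ⟨F, hF⟩ := exists_fixedPoint_of_causal
    (fun F => 1 + X * PowerSeries.mk fun n => A n * coeff n (fpow F (s + 1))) (by
    rintro (_ | n) a b hab
    · simp
    · simp only [map_add, coeff_succ_X_mul, coeff_mk]
      rw [X_pow_dvd_sub_iff.1 (dvd_fpow_sub_fpow hab _) n (Nat.lt_succ_self n)])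
  refine ⟨F, ?_, fun n => ?_⟩
  · rw [← hF]; simp
  · conv_lhs => rw [← hF]
    simp [coeff_succ_X_mul, coeff_one]

end

/-! ### Coefficientwise limits -/

/-- Coefficientwise convergence of formal power series. -/
def CoeffTendsto {ι : Type*} (A : ι → ℝ⟦X⟧) (l : Filter ι) (a : ℝ⟦X⟧) : Prop :=
  ∀ n, Tendsto (fun i => coeff n (A i)) l (𝓝 (coeff n a))

namespace CoeffTendsto

variable {ι : Type*} {l : Filter ι} {A B : ι → ℝ⟦X⟧} {a b : ℝ⟦X⟧}

lemma const (a : ℝ⟦X⟧) : CoeffTendsto (fun _ : ι => a) l a := fun _ => tendsto_const_nhds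

lemma congr' (h : ∀ n, ∀ᶠ i in l, coeff n (A i) = coeff n (B i)) (hA : CoeffTendsto A l a) :
    CoeffTendsto B l a := fun n => (hA n).congr' (h n)

lemma add (hA : CoeffTendsto A l a) (hB : CoeffTendsto B l b) :
    CoeffTendsto (fun i => A i + B i) l (a + b) := fun n => by
  simpa using (hA n).add (hB n)

lemma sub (hA : CoeffTendsto A l a) (hB : CoeffTendsto B l b) :
    CoeffTendsto (fun i => A i - B i) l (a - b) := fun n => by
  simpa using (hA n).sub (hB n)

lemma mul (hA : CoeffTendsto A l a) (hB : CoeffTendsto B l b) :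
    CoeffTendsto (fun i => A i * B i) l (a * b) := fun n => by
  simp only [coeff_mul]
  exact tendsto_finsetSum _ fun ij _ => (hA ij.1).mul (hB ij.2)

lemma pow (hA : CoeffTendsto A l a) (k : ℕ) : CoeffTendsto (fun i => A i ^ k) l (a ^ k) := by
  induction k with
  | zero => simpa using const (1 : ℝ⟦X⟧)
  | succ k ih => simpa only [pow_succ] using ih.mul hA

lemma C {c : ι → ℝ} {r : ℝ} (h : Tendsto c l (𝓝 r)) :
    CoeffTendsto (fun i => PowerSeries.C (c i)) l (PowerSeries.C r) := by
  rintro (_ | n)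
  · simpa using h
  · simp [tendsto_const_nhds]

lemma derivative (hA : CoeffTendsto A l a) :
    CoeffTendsto (fun i => d⁄dX ℝ (A i)) l (d⁄dX ℝ a) := fun n => by
  simp only [coeff_derivative]
  exact (hA (n + 1)).mul_const _

lemma rescale {c : ι → ℝ} {r : ℝ} (h : Tendsto c l (𝓝 r)) (hA : CoeffTendsto A l a) :
    CoeffTendsto (fun i => PowerSeries.rescale (c i) (A i)) l (PowerSeries.rescale r a) :=
  fun n => by
  simp only [coeff_rescale]
  exact (h.pow n).mul (hA n)

lemma fpow (hA : CoeffTendsto A l a) (h1 : ∀ᶠ i in l, constantCoeff (A i) = 1)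
    (ha : constantCoeff a = 1) (p : ℝ) :
    CoeffTendsto (fun i => fpow (A i) p) l (fpow a p) := fun n => by
  have hA' := (hA.sub (const (PowerSeries.C (1 : ℝ)))).pow
  have h2 : Tendsto (fun i => ∑ k ∈ Finset.range (n + 1),
      coeff k (taylorSeries (fun t => t ^ p) 1) * coeff n ((A i - PowerSeries.C 1) ^ k)) l
      (𝓝 (coeff n (DysonSchwinger.fpow a p))) := by
    rw [DysonSchwinger.fpow, coeff_comp _ _ (Nat.lt_succ_self n), ha]
    exact tendsto_finsetSum _ fun k _ => (hA' k n).const_mul _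
  refine h2.congr' ?_
  filter_upwards [h1] with i hi
  rw [DysonSchwinger.fpow, coeff_comp _ _ (Nat.lt_succ_self n), hi]

lemma run {s : ℝ} (hB : CoeffTendsto B l b) (hA : CoeffTendsto A l a)
    (h1 : ∀ᶠ i in l, constantCoeff (A i) = 1) (ha : constantCoeff a = 1) :
    CoeffTendsto (fun i => run s (B i) (A i)) l (run s b a) := fun n => by
  simp only [coeff_run]
  exact tendsto_finsetSum _ fun k _ =>
    (hB k).mul ((hA.mul ((hA.fpow h1 ha s).pow k)) (n - k))

lemma unique [l.NeBot] (hA : CoeffTendsto A l a) (hA' : CoeffTendsto A l b) : a = b := by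
  ext n
  exact tendsto_nhds_unique (hA n) (hA' n)

end CoeffTendsto

/-! ### The renormalization group equation of the regularized theory -/

/-- With `a` the counterterm, `α ∂_α` acts on the prefactor `a` and on the coupling `α a ^ s`, whose
logarithmic derivative is `1 + s α ∂_α ln a`. -/
lemma derivative_run {s : ℝ} {a : ℝ⟦X⟧} (ha : constantCoeff a = 1) (p : ℝ⟦X⟧) :
    X * d⁄dX ℝ (run s p a) = eulerLog a * run s p a +
      (1 + C s * eulerLog a) * run s (X * d⁄dX ℝ p) a := by
  have hs := hasSubst_X_mul (fpow a s)
  have haa : a * a⁻¹ = 1 := PowerSeries.mul_inv_cancel a (by rw [ha]; exact one_ne_zero)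
  have h1 := mul_derivative_fpow ha s
  have h2 : d⁄dX ℝ (fpow a s) = C s * fpow a s * d⁄dX ℝ a * a⁻¹ := by
    linear_combination a⁻¹ * h1 - d⁄dX ℝ (fpow a s) * haa
  simp only [run, eulerLog, Derivation.leibniz, smul_eq_mul, derivative_subst hs, subst_mul hs,
    subst_X hs, derivative_X, h2]
  linear_combination -X * p.subst (X * fpow a s : ℝ⟦X⟧) * d⁄dX ℝ a * haa

lemma constantCoeff_eulerLog (a : ℝ⟦X⟧) : constantCoeff (eulerLog a) = 0 := by
  simp [eulerLog]

lemma one_add_mul_inv (s : ℝ) (a : ℝ⟦X⟧) :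
    (1 + C s * eulerLog a) * (1 + C s * eulerLog a)⁻¹ = 1 :=
  PowerSeries.mul_inv_cancel _ (by simp [constantCoeff_eulerLog])

lemma betaReg_eq (s ε : ℝ) (z : ℝ⟦X⟧) : betaReg s ε z = C s * gammaReg s ε z := by
  rw [gammaReg, betaReg]
  linear_combination -C ε * one_add_mul_inv s z

/-- The renormalization group equation at `ε > 0`, with `- ε α ∂_α` of the bare series in the
role of the logarithmic derivative in the momentum. -/
lemma run_renormalizationGroup {s : ℝ} {z : ℝ⟦X⟧} (hz : constantCoeff z = 1) (ε : ℝ)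
    (p : ℝ⟦X⟧) :
    -C ε * run s (X * d⁄dX ℝ p) z = gammaReg s ε z * run s p z +
      (C s * gammaReg s ε z - C ε) * (X * d⁄dX ℝ (run s p z)) := by
  rw [← betaReg_eq, derivative_run hz, gammaReg, betaReg]
  linear_combination C ε * run s (X * d⁄dX ℝ p) z * one_add_mul_inv s z

/-! ### Limits of polynomials in `x ^ (-ε)` -/

namespace CoeffTendsto

variable {ι κ : Type*} {l : Filter ι}

lemma sum {A : κ → ι → ℝ⟦X⟧} {a : κ → ℝ⟦X⟧} (t : Finset κ)
    (h : ∀ k ∈ t, CoeffTendsto (A k) l (a k)) :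
    CoeffTendsto (fun i => ∑ k ∈ t, A k i) l (∑ k ∈ t, a k) := fun n => by
  simp only [map_sum]
  exact tendsto_finsetSum _ fun k hk => h k hk n

lemma prod {A : κ → ι → ℝ⟦X⟧} {a : κ → ℝ⟦X⟧} (t : Finset κ)
    (h : ∀ k ∈ t, CoeffTendsto (A k) l (a k)) :
    CoeffTendsto (fun i => ∏ k ∈ t, A k i) l (∏ k ∈ t, a k) := by
  classical
  induction t using Finset.induction_on with
  | empty => simpa using const 1
  | insert k t hk ih =>
    simp only [Finset.prod_insert hk]
    exact (h k (by simp)).mul (ih fun j hj => h j (by simp [hj]))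

/-- Interpolation polynomials depend continuously on the nodes and on the values. -/
lemma interpolate (t : Finset ℕ) {v : ι → ℕ → ℝ} {r : ι → ℕ → ℝ} {v₀ r₀ : ℕ → ℝ}
    (hv₀ : Set.InjOn v₀ t)
    (hv : ∀ k ∈ t, Tendsto (fun i => v i k) l (𝓝 (v₀ k)))
    (hr : ∀ k ∈ t, Tendsto (fun i => r i k) l (𝓝 (r₀ k))) :
    CoeffTendsto (fun i => ((Lagrange.interpolate t (v i) (r i) : Polynomial ℝ) : ℝ⟦X⟧)) l
      ((Lagrange.interpolate t v₀ r₀ : Polynomial ℝ) : ℝ⟦X⟧) := by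
  have hcoe : ∀ v r : ℕ → ℝ, ((Lagrange.interpolate t v r : Polynomial ℝ) : ℝ⟦X⟧) =
      ∑ k ∈ t, PowerSeries.C (r k) * ∏ j ∈ t.erase k,
        (PowerSeries.C (v k - v j)⁻¹ * (X - PowerSeries.C (v j))) := by
    intro v r
    rw [Lagrange.interpolate_apply, ← Polynomial.coeToPowerSeries.ringHom_apply]
    simp only [map_sum, map_mul, Lagrange.basis, Lagrange.basisDivisor, map_prod, map_sub,
      Polynomial.coeToPowerSeries.ringHom_apply, Polynomial.coe_C, Polynomial.coe_X]
  simp only [hcoe]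
  refine sum t fun k hk => (C (hr k hk)).mul (prod _ fun j hj => ?_)
  have hj' := Finset.mem_erase.1 hj
  refine (C (((hv k hk).sub (hv j hj'.2)).inv₀ ?_)).mul ((const X).sub (C (hv j hj'.2)))
  exact sub_ne_zero.2 fun h => hj'.1 (hv₀ hj'.2 hk h.symm)

lemma eval {N : ℕ} {A : ι → Polynomial ℝ} {a : Polynomial ℝ} (hN : ∀ i, (A i).natDegree < N)
    (ha : a.natDegree < N) (h : CoeffTendsto (fun i => (A i : ℝ⟦X⟧)) l a) {t : ι → ℝ} {t₀ : ℝ}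
    (ht : Tendsto t l (𝓝 t₀)) : Tendsto (fun i => (A i).eval (t i)) l (𝓝 (a.eval t₀)) := by
  rw [Polynomial.eval_eq_sum_range' ha]
  simp only [Polynomial.eval_eq_sum_range' (hN _)]
  refine tendsto_finsetSum _ fun k _ => Tendsto.mul ?_ (ht.pow k)
  simpa using h k

end CoeffTendsto

lemma tendsto_rpow_neg {x : ℝ} (hx : 0 < x) :
    Tendsto (fun ε : ℝ => x ^ (-ε)) (𝓝[>] 0) (𝓝 1) := by
  have : Continuous fun ε : ℝ => x ^ (-ε) := by
    simp only [Real.rpow_def_of_pos hx]; fun_prop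
  have h := (this.tendsto 0).mono_left (nhdsWithin_le_nhds (s := Ioi 0))
  simpa using h

lemma tendsto_one_sub_rpow_div {x : ℝ} (hx : 0 < x) :
    Tendsto (fun ε : ℝ => (1 - x ^ (-ε)) / ε) (𝓝[>] 0) (𝓝 (Real.log x)) := by
  have h1 : HasDerivAt (fun ε : ℝ => 1 - x ^ (-ε)) (Real.log x) 0 := by
    have := ((hasDerivAt_neg (0 : ℝ)).const_rpow hx).const_sub 1
    simpa using this
  have h2 := h1.tendsto_slope_zero_right
  refine h2.congr fun ε => ?_
  simp only [zero_add, neg_zero, Real.rpow_zero, sub_self, sub_zero, smul_eq_mul]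
  ring

/-- If polynomials of bounded degree in `x ^ (-ε)` converge for all `x > 0` as `ε → 0⁺`, then the
limit is a polynomial in `log x`, and the logarithmic derivatives in `x` converge to its
derivative.  In the variable `t = (1 - x ^ (-ε)) / ε → log x` this is convergence of
interpolation polynomials. -/
lemma exists_polynomial_log_of_tendsto {n : ℕ} {c : ℝ → ℕ → ℝ} {g : ℝ → ℝ}
    (h : ∀ x > 0, Tendsto (fun ε => ∑ k ∈ Finset.range (n + 1), c ε k * (x ^ (-ε)) ^ k)
      (𝓝[>] 0) (𝓝 (g x))) :
    ∃ P : Polynomial ℝ, (∀ x > 0, g x = P.eval (Real.log x)) ∧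
      ∀ x > 0, Tendsto (fun ε => ∑ k ∈ Finset.range (n + 1), c ε k * (-(ε * k)) * (x ^ (-ε)) ^ k)
        (𝓝[>] 0) (𝓝 (P.derivative.eval (Real.log x))) := by
  set t : ℝ → ℝ → ℝ := fun ε x => (1 - x ^ (-ε)) / ε with ht
  set r : ℝ → Polynomial ℝ := fun ε => ∑ k ∈ Finset.range (n + 1),
    Polynomial.C (c ε k) * (1 - Polynomial.C ε * Polynomial.X) ^ k with hr
  have hnode : ∀ ε > 0, ∀ x, 1 - ε * t ε x = x ^ (-ε) := fun ε hε x => by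
    simp only [ht]; rw [mul_div_cancel₀ _ (ne_of_gt hε)]; ring
  have hlin : ∀ ε : ℝ, (1 - Polynomial.C ε * Polynomial.X : Polynomial ℝ).natDegree ≤ 1 := by
    intro ε; compute_degree
  have hrdeg : ∀ ε, (r ε).natDegree < n + 1 := by
    intro ε
    refine Nat.lt_succ_of_le (Polynomial.natDegree_sum_le_of_forall_le _ _ fun k hk => ?_)
    refine (Polynomial.natDegree_C_mul_le _ _).trans (Polynomial.natDegree_pow_le.trans ?_)
    have := hlin ε
    have hk := Finset.mem_range.1 hk
    nlinarith
  have hreval : ∀ ε > 0, ∀ x, (r ε).eval (t ε x) =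
      ∑ k ∈ Finset.range (n + 1), c ε k * (x ^ (-ε)) ^ k := by
    intro ε hε x
    simp [hr, Polynomial.eval_finsetSum, hnode ε hε x]
  have hreval' : ∀ ε > 0, ∀ x > 0, (r ε).derivative.eval (t ε x) * x ^ (-ε) =
      ∑ k ∈ Finset.range (n + 1), c ε k * (-(ε * k)) * (x ^ (-ε)) ^ k := by
    intro ε hε x hx
    rw [hr, Polynomial.derivative_sum, Polynomial.eval_finsetSum, Finset.sum_mul]
    refine Finset.sum_congr rfl fun k _ => ?_
    rcases k with _ | k
    · simp
    · simp [Polynomial.derivative_pow, hnode ε hε x]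
      ring
  -- the nodes are `log 1, …, log (n + 1)` in the limit
  set v₀ : ℕ → ℝ := fun k => Real.log (k + 1) with hv₀
  have hpos : ∀ k : ℕ, (0 : ℝ) < k + 1 := fun k => by positivity
  have hinj : Set.InjOn v₀ (Finset.range (n + 1)) := by
    intro i _ j _ hij
    have := Real.log_injOn_pos (hpos i) (hpos j) hij
    exact_mod_cast add_right_cancel this
  set P := Lagrange.interpolate (Finset.range (n + 1)) v₀ fun k => g (k + 1) with hP
  have hPdeg : P.natDegree < n + 1 := by
    by_cases hP0 : P = 0
    · rw [hP0]; simp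
    · have := Lagrange.degree_interpolate_lt (fun k : ℕ => g (k + 1)) hinj
      rw [Finset.card_range] at this
      exact (Polynomial.natDegree_lt_iff_degree_lt hP0).2 this
  have hconv : CoeffTendsto (fun ε => (r ε : ℝ⟦X⟧)) (𝓝[>] 0) (P : ℝ⟦X⟧) := by
    refine CoeffTendsto.congr' (fun m => ?_) (CoeffTendsto.interpolate (l := 𝓝[>] (0 : ℝ))
      (v := fun ε k => t ε (k + 1)) (r := fun ε k => (r ε).eval (t ε (k + 1)))
      (Finset.range (n + 1)) hinj (fun k _ => tendsto_one_sub_rpow_div (hpos k)) fun k _ => ?_)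
    · filter_upwards [self_mem_nhdsWithin] with ε hε
      congr 2
      refine (Lagrange.eq_interpolate (v := fun k : ℕ => t ε (k + 1)) ?_ ?_).symm
      · intro i _ j _ hij
        have h1 : ((i : ℝ) + 1) ^ (-ε) = ((j : ℝ) + 1) ^ (-ε) := by
          rw [← hnode ε hε, ← hnode ε hε]; simp only at hij; rw [hij]
        have h2 := (Real.rpow_left_inj (hpos i).le (hpos j).le
          (neg_ne_zero.2 (ne_of_gt hε))).1 h1
        exact_mod_cast add_right_cancel h2
      · rw [Finset.card_range]
        exact lt_of_le_of_lt Polynomial.degree_le_natDegree (by exact_mod_cast hrdeg ε)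
    · refine (h _ (hpos k)).congr' ?_
      filter_upwards [self_mem_nhdsWithin] with ε hε
      rw [hreval ε hε]
  have hconv' : CoeffTendsto (fun ε => ((r ε).derivative : ℝ⟦X⟧)) (𝓝[>] 0)
      (P.derivative : ℝ⟦X⟧) := by
    simpa only [derivative_coe] using hconv.derivative
  refine ⟨P, fun x hx => ?_, fun x hx => ?_⟩
  · refine tendsto_nhds_unique (h x hx) ?_
    refine (hconv.eval hrdeg hPdeg (tendsto_one_sub_rpow_div hx)).congr' ?_
    filter_upwards [self_mem_nhdsWithin] with ε hε
    exact hreval ε hε x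
  · have h1 := (hconv'.eval (N := n + 1)
      (fun ε => lt_of_le_of_lt (Polynomial.natDegree_derivative_le _)
        (lt_of_le_of_lt (Nat.sub_le _ _) (hrdeg ε)))
      (lt_of_le_of_lt (Polynomial.natDegree_derivative_le _)
        (lt_of_le_of_lt (Nat.sub_le _ _) hPdeg)) (tendsto_one_sub_rpow_div hx)).mul
      (tendsto_rpow_neg hx)
    rw [mul_one] at h1
    refine h1.congr' ?_
    filter_upwards [self_mem_nhdsWithin] with ε hε
    exact hreval' ε hε x hx

/-! ### Solutions in terms of the bare series -/

/-- The bare series at regulator `ε`: the solution with `Z = 1`, as a series in `α x ^ (-ε)`. -/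
noncomputable def bareSeries (K : ℝ → ℝ → ℝ → ℝ) (s ε : ℝ) : ℝ⟦X⟧ :=
  (exists_bareSeries s fun k => amplitude K k ε).choose

section

variable {K : ℝ → ℝ → ℝ → ℝ} {f : ℕ → ℤ → ℝ} {s : ℝ} {Z : ℝ → ℝ⟦X⟧} {Gr : ℝ → ℝ → ℝ⟦X⟧}
  {G : ℝ → ℝ⟦X⟧} {γ : ℝ⟦X⟧}

lemma constantCoeff_bareSeries (K : ℝ → ℝ → ℝ → ℝ) (s ε : ℝ) :
    constantCoeff (bareSeries K s ε) = 1 :=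
  (exists_bareSeries s fun k => amplitude K k ε).choose_spec.1

lemma coeff_succ_bareSeries (K : ℝ → ℝ → ℝ → ℝ) (s ε : ℝ) (n : ℕ) :
    coeff (n + 1) (bareSeries K s ε) =
      amplitude K n ε * coeff n (fpow (bareSeries K s ε) (s + 1)) :=
  (exists_bareSeries s fun k => amplitude K k ε).choose_spec.2 n

/-- The solution of the regularized Dyson-Schwinger equation with counterterm `z`: the bare series
at the bare coupling `α z ^ s x ^ (-ε)`, multiplied by `z`. -/
noncomputable def regSolution (K : ℝ → ℝ → ℝ → ℝ) (s ε : ℝ) (z : ℝ⟦X⟧) (x : ℝ) : ℝ⟦X⟧ :=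
  run s (rescale (x ^ (-ε)) (bareSeries K s ε)) z

lemma constantCoeff_regSolution (K : ℝ → ℝ → ℝ → ℝ) (s ε : ℝ) (z : ℝ⟦X⟧) (x : ℝ) :
    constantCoeff (regSolution K s ε z x) = constantCoeff z := by
  rw [regSolution, constantCoeff_run, constantCoeff_rescale, constantCoeff_bareSeries, mul_one]

lemma coeff_regSolution (K : ℝ → ℝ → ℝ → ℝ) (s ε : ℝ) (z : ℝ⟦X⟧) (x : ℝ) (n : ℕ) :
    coeff n (regSolution K s ε z x) = ∑ k ∈ Finset.range (n + 1),
      coeff k (bareSeries K s ε) * coeff (n - k) (z * fpow z s ^ k) * (x ^ (-ε)) ^ k := by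
  rw [regSolution, coeff_run]
  refine Finset.sum_congr rfl fun k _ => ?_
  rw [coeff_rescale]
  ring

lemma coeff_fpow_regSolution {z : ℝ⟦X⟧} (hz : constantCoeff z = 1) (K : ℝ → ℝ → ℝ → ℝ)
    (s ε x : ℝ) (n : ℕ) :
    coeff n (fpow (regSolution K s ε z x) (s + 1)) = ∑ k ∈ Finset.range (n + 1),
      coeff k (fpow (bareSeries K s ε) (s + 1)) * coeff (n - k) (z * fpow z s ^ (k + 1)) *
        (x ^ (-ε)) ^ k := by
  rw [regSolution, fpow_run hz (by rw [constantCoeff_rescale, constantCoeff_bareSeries]),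
    fpow_rescale (constantCoeff_bareSeries K s ε), coeff_mul_subst_X_mul, fpow_add_one hz]
  refine Finset.sum_congr rfl fun k _ => ?_
  rw [coeff_rescale, show z * fpow z s * fpow z s ^ k = z * fpow z s ^ (k + 1) by ring]
  ring

lemma rpow_neg_pow {y : ℝ} (hy : 0 < y) (ε : ℝ) (k : ℕ) :
    (y ^ (-ε)) ^ k = y ^ (-(k * ε)) := by
  rw [← Real.rpow_mul_natCast hy.le]
  ring_nf

lemma SolvesDSE.constantCoeff_counterterm (h : SolvesDSE K s Z Gr) :
    ∀ᶠ ε in 𝓝[>] (0 : ℝ), constantCoeff (Z ε) = 1 := by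
  simpa using h.counterterm_zero

/-- Order by order in the coupling and for small `ε > 0`, every solution is determined by its
counterterm. -/
lemma SolvesDSE.coeff_eq_regSolution (hK : IsPropagatorKernel K f) (h : SolvesDSE K s Z Gr) :
    ∀ n, ∀ᶠ ε in 𝓝[>] (0 : ℝ), ∀ x > 0,
      coeff n (Gr ε x) = coeff n (regSolution K s ε (Z ε) x) := by
  intro n
  induction n using Nat.strong_induction_on with
  | _ n ih =>
    rcases n with _ | n
    · filter_upwards [h.order_zero] with ε hε x hx
      rw [hε x hx]
      simp [constantCoeff_regSolution]
    · have hlow : ∀ᶠ ε in 𝓝[>] (0 : ℝ), ∀ k ∈ Finset.range (n + 1), ∀ x > 0,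
          coeff k (Gr ε x) = coeff k (regSolution K s ε (Z ε) x) :=
        (Finset.eventually_all _).2 fun k hk => ih k (by simpa using hk)
      have hint : ∀ᶠ ε in 𝓝[>] (0 : ℝ), ∀ k ∈ Finset.range (n + 1), ∀ x > 0,
          IntegrableOn (fun y => K ε x y * y ^ (-(k * ε))) (Ioi 0) :=
        (Finset.eventually_all _).2 fun k _ => hK.integrable k
      have hscal : ∀ᶠ ε in 𝓝[>] (0 : ℝ), ∀ k ∈ Finset.range (n + 1), ∀ x > 0,
          ∫ y in Ioi 0, K ε x y * y ^ (-(k * ε)) = amplitude K k ε * x ^ (-((k + 1) * ε)) :=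
        (Finset.eventually_all _).2 fun k _ => hK.scaling k
      filter_upwards [hlow, hint, hscal, h.order_succ n, h.constantCoeff_counterterm] with
        ε hlow hint hscal hsucc hZ x hx
      set F := bareSeries K s ε with hF
      have hcomp : ∀ y ∈ Ioi (0 : ℝ), K ε x y * coeff n (comp (fun t => t ^ (s + 1)) (Gr ε y)) =
          ∑ k ∈ Finset.range (n + 1), (coeff k (fpow F (s + 1)) *
            coeff (n - k) (Z ε * fpow (Z ε) s ^ (k + 1))) * (K ε x y * y ^ (-(k * ε))) := by
        intro y hy
        rw [coeff_comp_congr _ (b := regSolution K s ε (Z ε) y)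
          (fun m hm => hlow m (Finset.mem_range.2 (Nat.lt_succ_of_le hm)) y hy), ← fpow,
          coeff_fpow_regSolution hZ, Finset.mul_sum]
        refine Finset.sum_congr rfl fun k _ => ?_
        rw [rpow_neg_pow hy]
        ring
      rw [hsucc x hx, setIntegral_congr_fun measurableSet_Ioi hcomp,
        integral_finsetSum _ fun k hk => (hint k hk x hx).const_mul _, coeff_regSolution,
        Finset.sum_range_succ' _ (n + 1), add_comm (coeff (n + 1) (Z ε))]
      refine congrArg₂ (· + ·) (Finset.sum_congr rfl fun k hk => ?_) ?_
      · rw [integral_const_mul, hscal k hk x hx, coeff_succ_bareSeries, rpow_neg_pow hx,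
          Nat.add_sub_add_right]
        push_cast
        ring
      · simp [constantCoeff_bareSeries]

/-! ### The physical limit -/

lemma IsPhysicalLimit.coeffTendsto (hK : IsPropagatorKernel K f) (h : SolvesDSE K s Z Gr)
    (hlim : IsPhysicalLimit s Z Gr G γ) {x : ℝ} (hx : 0 < x) :
    CoeffTendsto (fun ε => regSolution K s ε (Z ε) x) (𝓝[>] 0) (G x) :=
  CoeffTendsto.congr' (fun n => (h.coeff_eq_regSolution hK n).mono fun _ hε => hε x hx)
    fun n => hlim.green n x hx

lemma IsPhysicalLimit.constantCoeff_green (hK : IsPropagatorKernel K f) (h : SolvesDSE K s Z Gr)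
    (hlim : IsPhysicalLimit s Z Gr G γ) {x : ℝ} (hx : 0 < x) : constantCoeff (G x) = 1 := by
  have h0 := hlim.coeffTendsto hK h hx 0
  rw [coeff_zero_eq_constantCoeff_apply] at h0
  refine tendsto_nhds_unique h0 (tendsto_const_nhds.congr' ?_)
  filter_upwards [h.constantCoeff_counterterm] with ε hε
  rw [coeff_zero_eq_constantCoeff_apply, constantCoeff_regSolution, hε]

lemma MOMCondition.green_one (hM : MOMCondition Gr) (hlim : IsPhysicalLimit s Z Gr G γ) :
    G 1 = 1 := by
  ext n
  exact tendsto_nhds_unique (hlim.green n 1 one_pos)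
    (tendsto_const_nhds.congr' ((hM n).mono fun _ hε => hε.symm))

lemma coeff_run_congr {p q : ℝ⟦X⟧} {n : ℕ} (h : ∀ k ∈ Finset.range (n + 1), coeff k p = coeff k q)
    (a : ℝ⟦X⟧) : coeff n (run s p a) = coeff n (run s q a) := by
  rw [coeff_run, coeff_run]
  exact Finset.sum_congr rfl fun k hk => by rw [h k hk]

/-- Evolution of the momentum of an arbitrary solution `Gh` is the action of the kinematically
renormalized one.  At `ε > 0` the two solutions differ by a change of the counterterm, that is, by
the action of some `h` on the coupling; the kinematic condition identifies `h` with `Gh(α, y)`. -/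
lemma green_mul_eq_run (hK : IsPropagatorKernel K f) (h : SolvesDSE K s Z Gr)
    (hM : MOMCondition Gr) (hlim : IsPhysicalLimit s Z Gr G γ)
    {Zh : ℝ → ℝ⟦X⟧} {Grh : ℝ → ℝ → ℝ⟦X⟧} {Gh : ℝ → ℝ⟦X⟧} {γh : ℝ⟦X⟧}
    (hh : SolvesDSE K s Zh Grh) (hlimh : IsPhysicalLimit s Zh Grh Gh γh) {x y : ℝ}
    (hx : 0 < x) (hy : 0 < y) : Gh (x * y) = run s (G x) (Gh y) := by
  have hex : ∀ ε, ∃ b : ℝ⟦X⟧, constantCoeff b = 1 ∧ (constantCoeff (Z ε) = 1 →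
      constantCoeff (Zh ε) = 1 → run s (rescale (y ^ (-ε)) (Z ε)) b = Zh ε) := by
    intro ε
    by_cases h1 : constantCoeff (Z ε) = 1 ∧ constantCoeff (Zh ε) = 1
    · obtain ⟨b, hb, hb'⟩ := exists_run_eq s (p := rescale (y ^ (-ε)) (Z ε))
        (by rw [constantCoeff_rescale, h1.1]) h1.2
      exact ⟨b, hb, fun _ _ => hb'⟩
    · exact ⟨1, by simp, fun h2 h3 => absurd ⟨h2, h3⟩ h1⟩
  choose b hb hbZ using hex
  have hev : ∀ᶠ ε in 𝓝[>] (0 : ℝ), ∀ x' > 0, regSolution K s ε (Zh ε) (x' * y) =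
      run s (rescale (y ^ (-ε)) (regSolution K s ε (Z ε) x')) (b ε) := by
    filter_upwards [h.constantCoeff_counterterm, hh.constantCoeff_counterterm] with ε hZ hZh x' hx'
    have h1 : regSolution K s ε (Zh ε) (x' * y) =
        run s (rescale ((x' * y) ^ (-ε)) (bareSeries K s ε))
          (run s (rescale (y ^ (-ε)) (Z ε)) (b ε)) := by
      rw [hbZ ε hZ hZh, regSolution]
    rw [h1, run_run (hb ε) (by rw [constantCoeff_rescale, hZ]), regSolution,
      rescale_run hZ, rescale_rescale, Real.mul_rpow hx'.le hy.le]
  have hblim : CoeffTendsto b (𝓝[>] 0) (Gh y) := by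
    refine CoeffTendsto.congr' (fun n => ?_) (hlimh.coeffTendsto hK hh hy)
    have hMev : ∀ᶠ ε in 𝓝[>] (0 : ℝ), ∀ k ∈ Finset.range (n + 1),
        coeff k (regSolution K s ε (Z ε) 1) = coeff k (1 : ℝ⟦X⟧) := by
      refine (Finset.eventually_all _).2 fun k _ => ?_
      filter_upwards [hM k, h.coeff_eq_regSolution hK k] with ε h1 h2
      rw [← h2 1 one_pos, h1]
    filter_upwards [hev, hMev] with ε h1 h2
    have h3 := h1 1 one_pos
    rw [one_mul] at h3
    rw [h3, coeff_run_congr (q := 1), one_run]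
    intro k hk
    rw [coeff_rescale, h2 k hk]
    rcases k with _ | k
    · simp
    · simp [coeff_one]
  have hGh := hlimh.constantCoeff_green hK hh hy
  have hright := CoeffTendsto.run (s := s)
    ((hlim.coeffTendsto hK h hx).rescale (tendsto_rpow_neg hy)) hblim
    (Eventually.of_forall hb) hGh
  rw [rescale_one, RingHom.id_apply] at hright
  refine CoeffTendsto.unique (hlimh.coeffTendsto hK hh (mul_pos hx hy)) ?_
  exact CoeffTendsto.congr' (fun n => hev.mono fun ε hε => by rw [hε x hx]) hright

/-! ### Expansion in the logarithm of the momentum -/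

/-- Polynomial-valued Green functions: a series over `ℝ[L]`, evaluated at a real `L`. -/
noncomputable def evalLog (P : (Polynomial ℝ)⟦X⟧) (L : ℝ) : ℝ⟦X⟧ :=
  PowerSeries.map (Polynomial.evalRingHom L) P

lemma coeff_evalLog (P : (Polynomial ℝ)⟦X⟧) (L : ℝ) (n : ℕ) :
    coeff n (evalLog P L) = (coeff n P).eval L := by
  simp [evalLog]

/-- The coefficientwise derivative `∂/∂L` on series over `ℝ[L]`. -/
noncomputable def derivLog (P : (Polynomial ℝ)⟦X⟧) : (Polynomial ℝ)⟦X⟧ :=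
  PowerSeries.mk fun n => (coeff n P).derivative

/-- The physical Green function is polynomial in `log x` at every order, and satisfies the
renormalization group equation. -/
lemma IsPhysicalLimit.exists_log_expansion (hK : IsPropagatorKernel K f)
    (h : SolvesDSE K s Z Gr) (hlim : IsPhysicalLimit s Z Gr G γ) :
    ∃ P : (Polynomial ℝ)⟦X⟧, (∀ x > 0, G x = evalLog P (Real.log x)) ∧
      ∀ x > 0, evalLog (derivLog P) (Real.log x) =
        γ * G x + C s * γ * (X * d⁄dX ℝ (G x)) := by
  have key : ∀ n, ∃ P : Polynomial ℝ, (∀ x > 0, coeff n (G x) = P.eval (Real.log x)) ∧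
      ∀ x > 0, Tendsto (fun ε => coeff n (-C ε *
        run s (X * d⁄dX ℝ (rescale (x ^ (-ε)) (bareSeries K s ε))) (Z ε)))
        (𝓝[>] 0) (𝓝 (P.derivative.eval (Real.log x))) := by
    intro n
    obtain ⟨P, hP, hP'⟩ := exists_polynomial_log_of_tendsto (n := n)
      (c := fun ε k => coeff k (bareSeries K s ε) * coeff (n - k) (Z ε * fpow (Z ε) s ^ k))
      (g := fun x => coeff n (G x)) fun x hx => by
        simpa only [coeff_regSolution] using hlim.coeffTendsto hK h hx n
    refine ⟨P, hP, fun x hx => (hP' x hx).congr fun ε => ?_⟩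
    rw [← map_neg, coeff_C_mul, coeff_run, Finset.mul_sum]
    refine Finset.sum_congr rfl fun k _ => ?_
    rcases k with _ | k
    · simp
    · rw [coeff_succ_X_mul, coeff_derivative, coeff_rescale]
      push_cast
      ring
  choose P hP hP' using key
  refine ⟨PowerSeries.mk P, fun x hx => ?_, fun x hx => ?_⟩
  · ext n
    rw [hP n x hx, coeff_evalLog, coeff_mk]
  · have h1 : CoeffTendsto (fun ε => -C ε *
        run s (X * d⁄dX ℝ (rescale (x ^ (-ε)) (bareSeries K s ε))) (Z ε)) (𝓝[>] 0)
        (evalLog (derivLog (PowerSeries.mk P)) (Real.log x)) := fun n => by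
      rw [coeff_evalLog, derivLog, coeff_mk, coeff_mk]
      exact hP' n x hx
    have hG := hlim.coeffTendsto hK h hx
    have hγ : CoeffTendsto (fun ε => gammaReg s ε (Z ε)) (𝓝[>] 0) γ := hlim.anomalous
    have hε : CoeffTendsto (fun ε : ℝ => (C ε : ℝ⟦X⟧)) (𝓝[>] 0) (C 0) :=
      CoeffTendsto.C (tendsto_id.mono_left nhdsWithin_le_nhds)
    have h2 := (hγ.mul hG).add
      ((((CoeffTendsto.const (C s)).mul hγ).sub hε).mul
        ((CoeffTendsto.const X).mul hG.derivative))
    rw [map_zero, sub_zero] at h2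
    refine h1.unique (CoeffTendsto.congr' (fun n => ?_) h2)
    filter_upwards [h.constantCoeff_counterterm] with ε hZ
    rw [run_renormalizationGroup hZ]
    rfl

end

/-! ### The first order in the coupling -/

section

variable {K : ℝ → ℝ → ℝ → ℝ} {f : ℕ → ℤ → ℝ} {s : ℝ} {Z : ℝ → ℝ⟦X⟧} {Gr : ℝ → ℝ → ℝ⟦X⟧}
  {G : ℝ → ℝ⟦X⟧} {γ : ℝ⟦X⟧}

lemma IsPropagatorKernel.tendsto_amplitude_sub_pole (hK : IsPropagatorKernel K f) :
    Tendsto (fun ε => amplitude K 0 ε - f 0 (-1) * ε⁻¹) (𝓝[>] 0) (𝓝 (f 0 0)) := by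
  have hsum : ∀ ε, HasSum (fun m : ℕ => f 0 ((m : ℤ) - 1) * ε ^ ((m : ℤ) - 1)) (amplitude K 0 ε) →
      HasSum (fun m : ℕ => f 0 m * ε ^ m) (amplitude K 0 ε - f 0 (-1) * ε⁻¹) := by
    intro ε h
    have := (hasSum_nat_add_iff' 1).2 h
    simpa using this
  obtain ⟨ε₁, h₁, hε₁⟩ := ((hK.laurent 0).and self_mem_nhdsWithin).exists
  have hε₁' : (0 : ℝ) < ε₁ := hε₁
  have hlim : Tendsto (fun ε : ℝ => ∑' m : ℕ, f 0 m * ε ^ m) (𝓝[>] 0)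
      (𝓝 (∑' m : ℕ, f 0 m * (0 : ℝ) ^ m)) := by
    refine tendsto_tsum_of_dominated_convergence (hsum ε₁ h₁).summable.norm (fun m => ?_) ?_
    · have : Continuous fun ε : ℝ => f 0 m * ε ^ m := by fun_prop
      exact (this.tendsto 0).mono_left nhdsWithin_le_nhds
    · filter_upwards [Ioo_mem_nhdsGT hε₁'] with ε hε m
      rw [norm_mul, norm_mul, norm_pow, norm_pow, Real.norm_of_nonneg hε.1.le,
        Real.norm_of_nonneg hε₁'.le]
      gcongr
      · exact hε.1.le
      · exact hε.2.le
  rw [tsum_eq_single 0 fun m hm => by simp [hm]] at hlim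
  simp only [Nat.cast_zero, pow_zero, mul_one] at hlim
  exact hlim.congr' ((hK.laurent 0).mono fun ε hε => (hsum ε hε).tsum_eq)

lemma coeff_one_regSolution {z : ℝ⟦X⟧} (hz : constantCoeff z = 1) (K : ℝ → ℝ → ℝ → ℝ)
    (s ε x : ℝ) :
    coeff 1 (regSolution K s ε z x) = coeff 1 z + amplitude K 0 ε * x ^ (-ε) := by
  have h1 : coeff 1 (bareSeries K s ε) = amplitude K 0 ε := by
    rw [show 1 = 0 + 1 from rfl, coeff_succ_bareSeries, coeff_zero_eq_constantCoeff_apply,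
      constantCoeff_fpow (constantCoeff_bareSeries K s ε), mul_one]
  rw [coeff_regSolution, Finset.sum_range_succ, Finset.sum_range_one, h1]
  simp [constantCoeff_bareSeries, hz, constantCoeff_fpow hz]

lemma coeff_one_gammaReg {z : ℝ⟦X⟧} (hz : constantCoeff z = 1) (s ε : ℝ) :
    coeff 1 (gammaReg s ε z) = ε * coeff 1 z := by
  have h1 : coeff 1 (eulerLog z) = coeff 1 z := by
    have : coeff 0 (d⁄dX ℝ z) = coeff 1 z := by simp only [coeff_derivative]; simp
    rw [eulerLog, mul_assoc, show 1 = 0 + 1 from rfl, coeff_succ_X_mul,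
      coeff_zero_eq_constantCoeff_apply, map_mul, ← coeff_zero_eq_constantCoeff_apply (d⁄dX ℝ z),
      this]
    simp [hz]
  have h0 := constantCoeff_eulerLog z
  rw [gammaReg, betaReg, sub_sub_cancel, coeff_mul,
    Finset.Nat.sum_antidiagonal_eq_sum_range_succ_mk, Finset.sum_range_succ, Finset.sum_range_one]
  simp [h1, h0]

lemma coeff_one_anomalous_of_MOM (hK : IsPropagatorKernel K f) (h : SolvesDSE K s Z Gr)
    (hM : MOMCondition Gr) (hlim : IsPhysicalLimit s Z Gr G γ) : coeff 1 γ = -f 0 (-1) := by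
  have hid : Tendsto (fun ε : ℝ => ε) (𝓝[>] 0) (𝓝 0) := tendsto_id.mono_left nhdsWithin_le_nhds
  have h1 : Tendsto (fun ε => -(ε * (amplitude K 0 ε - f 0 (-1) * ε⁻¹) + f 0 (-1)))
      (𝓝[>] 0) (𝓝 (-f 0 (-1))) := by
    simpa using ((hid.mul hK.tendsto_amplitude_sub_pole).add_const (f 0 (-1))).neg
  refine tendsto_nhds_unique (hlim.anomalous 1) (h1.congr' ?_)
  filter_upwards [h.constantCoeff_counterterm, hM 1, h.coeff_eq_regSolution hK 1,
    self_mem_nhdsWithin] with ε hZ hM1 hreg hε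
  have hε' : ε ≠ 0 := ne_of_gt hε
  have h2 := hreg 1 one_pos
  rw [hM1, coeff_one_regSolution hZ, Real.one_rpow, mul_one] at h2
  have h3 : coeff 1 (Z ε) = -amplitude K 0 ε := by
    have : coeff 1 (1 : ℝ⟦X⟧) = 0 := by simp [coeff_one]
    linarith
  rw [coeff_one_gammaReg hZ, h3]
  field_simp
  ring

lemma coeff_one_green_of_MS (hK : IsPropagatorKernel K f) (h : SolvesDSE K s Z Gr)
    (hM : MSCondition Z) (hlim : IsPhysicalLimit s Z Gr G γ) : coeff 1 (G 1) = f 0 0 := by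
  obtain ⟨p, hp0, hp⟩ := hM 1 le_rfl
  -- the poles of the counterterm and of the primitive integral have to cancel
  set q : Polynomial ℝ := p + Polynomial.C (f 0 (-1)) * Polynomial.X with hq
  have h1 : Tendsto (fun ε : ℝ => q.eval ε⁻¹) (𝓝[>] 0) (𝓝 (coeff 1 (G 1) - f 0 0)) := by
    refine ((hlim.green 1 1 one_pos).sub hK.tendsto_amplitude_sub_pole).congr' ?_
    filter_upwards [h.constantCoeff_counterterm, hp, h.coeff_eq_regSolution hK 1] with ε hZ hp hreg
    rw [hreg 1 one_pos, coeff_one_regSolution hZ, hp]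
    simp only [hq, Real.one_rpow, mul_one, Polynomial.eval_add, Polynomial.eval_mul,
      Polynomial.eval_C, Polynomial.eval_X]
    ring
  have h2 : Tendsto (fun T : ℝ => q.eval T) atTop (𝓝 (coeff 1 (G 1) - f 0 0)) := by
    refine (h1.comp tendsto_inv_atTop_nhdsGT_zero).congr fun T => ?_
    simp
  obtain ⟨hl, hd⟩ := (Polynomial.tendsto_nhds_iff q).1 h2
  have h3 : q = 0 := by
    rw [Polynomial.eq_C_of_degree_le_zero hd]
    simp [hq, hp0]
  rw [h3, Polynomial.leadingCoeff_zero] at hl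
  linarith

end

/-! ### Evaluation at a formal logarithm -/

/-- `∑ₙ αⁿ Pₙ(ℓ(α))` for the series `∑ₙ αⁿ Pₙ(L)` over `ℝ[L]`, as a bare function; see
`evalSeries`. -/
noncomputable def evalSeriesFun (ℓ : ℝ⟦X⟧) (P : (Polynomial ℝ)⟦X⟧) : ℝ⟦X⟧ :=
  PowerSeries.mk fun N => ∑ n ∈ Finset.range (N + 1),
    coeff (N - n) (Polynomial.aeval ℓ (coeff n P))

section

variable (ℓ : ℝ⟦X⟧)

lemma coeff_sum_X_pow_mul (A : ℕ → ℝ⟦X⟧) {m N : ℕ} (h : m < N) :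
    coeff m (∑ n ∈ Finset.range N, X ^ n * A n) =
      ∑ n ∈ Finset.range (m + 1), coeff (m - n) (A n) := by
  rw [map_sum, ← Finset.sum_subset (Finset.range_subset_range.2 (Nat.succ_le_of_lt h))]
  · refine Finset.sum_congr rfl fun n hn => ?_
    rw [coeff_X_pow_mul', if_pos (Nat.lt_succ_iff.1 (Finset.mem_range.1 hn))]
  · intro n _ hn
    rw [coeff_X_pow_mul', if_neg]
    simpa using hn

lemma X_pow_dvd_evalSeriesFun_sub (P : (Polynomial ℝ)⟦X⟧) (N : ℕ) :
    X ^ N ∣ evalSeriesFun ℓ P -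
      ∑ n ∈ Finset.range N, X ^ n * Polynomial.aeval ℓ (coeff n P) := by
  rw [X_pow_dvd_sub_iff]
  intro m hm
  rw [coeff_sum_X_pow_mul _ hm, evalSeriesFun, coeff_mk]

lemma X_pow_dvd_evalSeriesFun_sub_eval₂ {P : (Polynomial ℝ)⟦X⟧}
    {p : Polynomial (Polynomial ℝ)} {N : ℕ} (h : X ^ N ∣ P - (p : (Polynomial ℝ)⟦X⟧)) :
    X ^ N ∣ evalSeriesFun ℓ P -
      Polynomial.eval₂RingHom (Polynomial.aeval ℓ : Polynomial ℝ →ₐ[ℝ] ℝ⟦X⟧).toRingHom X p := by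
  rw [X_pow_dvd_sub_iff] at h ⊢
  intro m hm
  have h1 : Polynomial.eval₂RingHom (Polynomial.aeval ℓ : Polynomial ℝ →ₐ[ℝ] ℝ⟦X⟧).toRingHom X p =
      ∑ n ∈ Finset.range (p.natDegree + (m + 1)), X ^ n * Polynomial.aeval ℓ (p.coeff n) := by
    rw [Polynomial.coe_eval₂RingHom,
      Polynomial.eval₂_eq_sum_range' _ (show p.natDegree < p.natDegree + (m + 1) by omega)]
    exact Finset.sum_congr rfl fun n _ => mul_comm _ _
  rw [h1, coeff_sum_X_pow_mul _ (by omega), evalSeriesFun, coeff_mk]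
  refine Finset.sum_congr rfl fun n hn => ?_
  rw [h n (by have := Finset.mem_range.1 hn; omega), Polynomial.coeff_coe]

lemma eq_of_forall_X_pow_dvd_sub {a b : ℝ⟦X⟧} (h : ∀ N : ℕ, X ^ N ∣ a - b) : a = b := by
  ext n
  exact X_pow_dvd_sub_iff.1 (h (n + 1)) n (Nat.lt_succ_self n)

lemma evalSeriesFun_mul (P Q : (Polynomial ℝ)⟦X⟧) :
    evalSeriesFun ℓ (P * Q) = evalSeriesFun ℓ P * evalSeriesFun ℓ Q := by
  refine eq_of_forall_X_pow_dvd_sub fun N => ?_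
  have hP : (X : (Polynomial ℝ)⟦X⟧) ^ N ∣ P - (trunc N P : Polynomial (Polynomial ℝ)) :=
    X_pow_dvd_sub_iff.2 fun m hm => (coeff_coe_trunc_of_lt hm).symm
  have hQ : (X : (Polynomial ℝ)⟦X⟧) ^ N ∣ Q - (trunc N Q : Polynomial (Polynomial ℝ)) :=
    X_pow_dvd_sub_iff.2 fun m hm => (coeff_coe_trunc_of_lt hm).symm
  have hPQ : (X : (Polynomial ℝ)⟦X⟧) ^ N ∣ P * Q -
      ((trunc N P * trunc N Q : Polynomial (Polynomial ℝ)) : (Polynomial ℝ)⟦X⟧) := by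
    rw [Polynomial.coe_mul]
    exact dvd_mul_sub_mul_of_dvd hP hQ
  have h1 := X_pow_dvd_evalSeriesFun_sub_eval₂ ℓ hPQ
  rw [map_mul] at h1
  have h2 := dvd_mul_sub_mul_of_dvd (X_pow_dvd_evalSeriesFun_sub_eval₂ ℓ hP)
    (X_pow_dvd_evalSeriesFun_sub_eval₂ ℓ hQ)
  simpa using dvd_sub h1 h2

lemma evalSeriesFun_C (q : Polynomial ℝ) :
    evalSeriesFun ℓ (C q) = Polynomial.aeval ℓ q := by
  ext N
  rw [evalSeriesFun, coeff_mk, Finset.sum_eq_single 0]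
  · simp
  · intro n _ hn
    simp [coeff_C, hn]
  · simp

/-- The ring homomorphism `G(α, L) ↦ G(α, ℓ(α))` from series over `ℝ[L]`. -/
noncomputable def evalSeries : (Polynomial ℝ)⟦X⟧ →+* ℝ⟦X⟧ where
  toFun := evalSeriesFun ℓ
  map_one' := by simpa using evalSeriesFun_C ℓ 1
  map_mul' := evalSeriesFun_mul ℓ
  map_zero' := by simpa using evalSeriesFun_C ℓ 0
  map_add' P Q := by
    ext N
    simp [evalSeriesFun, Finset.sum_add_distrib]

lemma coeff_evalSeries (P : (Polynomial ℝ)⟦X⟧) (N : ℕ) : coeff N (evalSeries ℓ P) =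
    ∑ n ∈ Finset.range (N + 1), coeff (N - n) (Polynomial.aeval ℓ (coeff n P)) := by
  change coeff N (evalSeriesFun ℓ P) = _
  rw [evalSeriesFun, coeff_mk]

@[simp]
lemma evalSeries_C (q : Polynomial ℝ) : evalSeries ℓ (C q) = Polynomial.aeval ℓ q :=
  evalSeriesFun_C ℓ q

lemma evalSeries_map_C (a : ℝ⟦X⟧) :
    evalSeries ℓ (PowerSeries.map Polynomial.C a) = a := by
  ext N
  rw [coeff_evalSeries, Finset.sum_eq_single N]
  · simp
  · intro n hn hnN
    have := Finset.mem_range.1 hn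
    have : N - n ≠ 0 := by omega
    simp [coeff_C, this]
  · simp

@[simp]
lemma evalSeries_X : evalSeries ℓ X = X := by
  simpa using evalSeries_map_C ℓ X

lemma X_pow_dvd_evalSeries {P : (Polynomial ℝ)⟦X⟧} {N : ℕ} (h : X ^ N ∣ P) :
    X ^ N ∣ evalSeries ℓ P := by
  simpa using map_dvd (evalSeries ℓ) h

lemma coeff_mul_evalSeries (b : ℝ⟦X⟧) (P : (Polynomial ℝ)⟦X⟧) (N : ℕ) :
    coeff N (b * evalSeries ℓ P) =
      ∑ n ∈ Finset.range (N + 1), coeff (N - n) (b * Polynomial.aeval ℓ (coeff n P)) := by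
  have h := (X_pow_dvd_evalSeriesFun_sub ℓ P (N + 1)).mul_left b
  rw [mul_sub, X_pow_dvd_sub_iff] at h
  refine (h N (Nat.lt_succ_self N)).trans ?_
  rw [Finset.mul_sum, ← coeff_sum_X_pow_mul _ (Nat.lt_succ_self N)]
  congr 1
  exact Finset.sum_congr rfl fun n _ => by ring

lemma coeff_X_mul_derivative {R : Type*} [CommRing R] (a : R⟦X⟧) (n : ℕ) :
    coeff n (X * d⁄dX R a) = n * coeff n a := by
  rcases n with _ | n
  · simp
  · rw [coeff_succ_X_mul, coeff_derivative]
    push_cast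
    ring

/-- The chain rule for the evaluation at a formal logarithm. -/
lemma X_mul_derivative_evalSeries (P : (Polynomial ℝ)⟦X⟧) :
    X * d⁄dX ℝ (evalSeries ℓ P) =
      evalSeries ℓ (X * d⁄dX (Polynomial ℝ) P) +
        X * d⁄dX ℝ ℓ * evalSeries ℓ (derivLog P) := by
  ext N
  rw [coeff_X_mul_derivative, map_add, coeff_mul_evalSeries, coeff_evalSeries, coeff_evalSeries,
    Finset.mul_sum, ← Finset.sum_add_distrib]
  refine Finset.sum_congr rfl fun n hn => ?_
  have hn' : n ≤ N := Nat.lt_succ_iff.1 (Finset.mem_range.1 hn)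
  have h1 : X * d⁄dX ℝ ℓ * Polynomial.aeval ℓ (coeff n (derivLog P)) =
      X * d⁄dX ℝ (Polynomial.aeval ℓ (coeff n P)) := by
    rw [derivLog, coeff_mk, Derivation.comp_aeval_eq (a := ℓ) (PowerSeries.derivative ℝ),
      smul_eq_mul]
    ring
  rw [h1, coeff_X_mul_derivative, coeff_X_mul_derivative, map_mul, map_natCast,
    ← map_natCast (C : ℝ →+* ℝ⟦X⟧), coeff_C_mul, Nat.cast_sub hn']
  ring

/-- Evaluation of `G(α, L + c)`. -/
lemma evalSeries_shift (c : ℝ) (P : (Polynomial ℝ)⟦X⟧) :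
    evalSeries ℓ (PowerSeries.mk fun n =>
      (coeff n P).comp (Polynomial.X + Polynomial.C c)) = evalSeries (ℓ + C c) P := by
  ext N
  rw [coeff_evalSeries, coeff_evalSeries]
  refine Finset.sum_congr rfl fun n _ => ?_
  rw [coeff_mk, Polynomial.aeval_comp]
  congr 2
  simp

end

/-! ### Transfer of the running coupling to formal logarithms -/

section

variable {B : Type*} [CommRing B] [Algebra ℝ B]

/-- A finite expression in `b` that agrees with `run s c b` up to terms of order `N`; it makes
sense over every `ℝ`-algebra. -/
noncomputable def runTrunc (s : ℝ) (c : ℝ⟦X⟧) (N : ℕ) (b : B⟦X⟧) : B⟦X⟧ :=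
  b * ∑ k ∈ Finset.range N, C (algebraMap ℝ B (coeff k c)) *
    (X * ∑ j ∈ Finset.range N,
      C (algebraMap ℝ B (coeff j (taylorSeries (fun t => t ^ s) 1))) * (b - 1) ^ j) ^ k

lemma X_pow_dvd_run_sub_runTrunc (s : ℝ) (c : ℝ⟦X⟧) (N : ℕ) {a : ℝ⟦X⟧}
    (ha : constantCoeff a = 1) : X ^ N ∣ run s c a - runTrunc s c N a := by
  set r : ℝ⟦X⟧ := ∑ j ∈ Finset.range N,
    C (algebraMap ℝ ℝ (coeff j (taylorSeries (fun t => t ^ s) 1))) * (a - 1) ^ j with hr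
  have h1 : X ^ N ∣ fpow a s - r := by
    rw [X_pow_dvd_sub_iff]
    intro m hm
    rw [fpow, coeff_comp _ _ hm, ha, hr, map_sum]
    simp
  have h2 : X ^ N ∣ c.subst (X * fpow a s : ℝ⟦X⟧) -
      ∑ k ∈ Finset.range N, C (coeff k c) * (X * fpow a s) ^ k := by
    rw [X_pow_dvd_sub_iff]
    intro m hm
    rw [coeff_subst_eq_sum (by simp) _ hm, map_sum]
    simp
  have h3 : X ^ N ∣ ∑ k ∈ Finset.range N, C (coeff k c) * (X * fpow a s) ^ k -
      ∑ k ∈ Finset.range N, C (coeff k c) * (X * r) ^ k := by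
    rw [← Finset.sum_sub_distrib]
    refine Finset.dvd_sum fun k _ => ?_
    rw [← mul_sub]
    refine Dvd.dvd.mul_left (Dvd.dvd.trans ?_ (sub_dvd_pow_sub_pow _ _ k)) _
    rw [← mul_sub]
    exact h1.mul_left X
  have h4 := (dvd_add h2 h3).mul_left a
  rw [sub_add_sub_cancel, mul_sub] at h4
  exact h4

lemma map_runTrunc (s : ℝ) (c : ℝ⟦X⟧) (N : ℕ) (e : B⟦X⟧ →+* ℝ⟦X⟧) (hX : e X = X)
    (hC : ∀ r : ℝ, e (C (algebraMap ℝ B r)) = C r) (b : B⟦X⟧) :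
    e (runTrunc s c N b) = runTrunc s c N (e b) := by
  simp [runTrunc, hX, hC]

/-- An identity `A(L) = G(L) c(α G(L) ^ s)` for all real `L` persists for `L = ℓ(α)`. -/
lemma evalSeries_eq_run {s : ℝ} {c : ℝ⟦X⟧} {A P : (Polynomial ℝ)⟦X⟧}
    (hP : coeff 0 P = 1) (h : ∀ L, evalLog A L = run s c (evalLog P L)) (ℓ : ℝ⟦X⟧) :
    evalSeries ℓ A = run s c (evalSeries ℓ P) := by
  refine eq_of_forall_X_pow_dvd_sub fun N => ?_
  have h1 : X ^ N ∣ A - runTrunc s c N P := by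
    rw [X_pow_dvd_sub_iff]
    intro m hm
    refine Polynomial.funext fun L => ?_
    rw [← coeff_evalLog, ← coeff_evalLog, h L, evalLog, evalLog,
      map_runTrunc s c N _ (by simp) (by simp)]
    refine X_pow_dvd_sub_iff.1 (X_pow_dvd_run_sub_runTrunc s c N ?_) m hm
    rw [← coeff_zero_eq_constantCoeff_apply, coeff_map, hP]
    simp
  have h2 := X_pow_dvd_evalSeries ℓ h1
  rw [map_sub, map_runTrunc s c N _ (evalSeries_X ℓ) (fun r => by
    rw [evalSeries_C, AlgHom.commutes, PowerSeries.algebraMap_apply,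
      Algebra.algebraMap_self_apply])] at h2
  have h3 := X_pow_dvd_run_sub_runTrunc s c N (a := evalSeries ℓ P) (by
    rw [← coeff_zero_eq_constantCoeff_apply, coeff_evalSeries]
    simp [hP])
  simpa using dvd_sub h2 h3

end

/-! ### Formal logarithms of momenta -/

section

variable {a b : ℝ⟦X⟧}

lemma mul_derivative_log (ha : 0 < constantCoeff a) :
    a * d⁄dX ℝ (comp Real.log a) = d⁄dX ℝ a := by
  have h1 : a * comp (fun t => t⁻¹) a = 1 := by
    have h : a * comp (fun t => t⁻¹) a = comp (fun t => t) a * comp (fun t => t⁻¹) a := by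
      rw [comp_id]
    rw [h, ← comp_mul contDiffAt_fun_id (contDiffAt_inv _ ha.ne'), ← map_one (C : ℝ →+* ℝ⟦X⟧),
      ← comp_const 1 a]
    refine comp_congr ?_
    filter_upwards [eventually_ne_nhds ha.ne'] with t ht
    exact mul_inv_cancel₀ ht
  rw [derivative_comp, Real.deriv_log', ← mul_assoc, h1, one_mul]

/-- `ln` is characterized by its derivative and constant coefficient. -/
lemma comp_log_eq_of_mul_derivative (ha : 0 < constantCoeff a)
    (h0 : constantCoeff b = Real.log (constantCoeff a)) (h : a * d⁄dX ℝ b = d⁄dX ℝ a) :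
    comp Real.log a = b := by
  have ha' : a ≠ 0 := fun h => by rw [h, map_zero] at ha; exact lt_irrefl _ ha
  refine derivative.ext (mul_left_cancel₀ ha' ?_) (by rw [constantCoeff_comp, h0])
  rw [mul_derivative_log ha, h]

lemma comp_log_C_mul {x : ℝ} (hx : 0 < x) (ha : 0 < constantCoeff a) :
    comp Real.log (C x * a) = comp Real.log a + C (Real.log x) := by
  refine comp_log_eq_of_mul_derivative (by simpa using mul_pos hx ha) ?_ ?_
  · simp [Real.log_mul hx.ne' ha.ne', add_comm]
  · have := mul_derivative_log ha
    simp only [map_add, derivative_C, Derivation.leibniz, smul_eq_mul]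
    linear_combination C x * this

lemma exists_comp_log_eq (ℓ : ℝ⟦X⟧) : ∃ a, 0 < constantCoeff a ∧ comp Real.log a = ℓ := by
  have h0 : 0 < constantCoeff (comp Real.exp ℓ) := by
    rw [constantCoeff_comp]; exact Real.exp_pos _
  refine ⟨comp Real.exp ℓ, h0, comp_log_eq_of_mul_derivative h0 (by simp) ?_⟩
  rw [derivative_comp, Real.deriv_exp]

lemma comp_log_injective (ha : 0 < constantCoeff a) (hb : 0 < constantCoeff b)
    (h : comp Real.log a = comp Real.log b) : a = b := by
  have h0 : constantCoeff a = constantCoeff b := by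
    have := congrArg constantCoeff h
    rw [constantCoeff_comp, constantCoeff_comp] at this
    exact Real.log_injOn_pos ha hb this
  refine eq_of_mul_derivative_eq (a := a) (p := 1) ha.ne' ha.ne' h0 (by simp) ?_
  have h1 := mul_derivative_log ha
  have h2 := mul_derivative_log hb
  rw [map_one, ← h1, ← h2, h]
  ring

lemma comp_eval_log (ha : 0 < constantCoeff a) (P : Polynomial ℝ) :
    comp (fun x => P.eval (Real.log x)) a = Polynomial.aeval (comp Real.log a) P := by
  have hd : ∀ P : Polynomial ℝ, ContDiffAt ℝ ⊤ (fun x => P.eval (Real.log x)) (constantCoeff a) :=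
    fun P => (Polynomial.contDiff_aeval P ⊤).contDiffAt.comp _ (Real.contDiffAt_log.2 ha.ne')
  induction P using Polynomial.induction_on' with
  | add p q hp hq =>
    simp only [Polynomial.eval_add, map_add]
    rw [comp_add (hd p) (hd q), hp, hq]
  | monomial n c =>
    induction n with
    | zero =>
      simp only [Polynomial.monomial_zero_left, Polynomial.eval_C, comp_const]
      rw [Polynomial.aeval_C, PowerSeries.algebraMap_apply, Algebra.algebraMap_self_apply]
    | succ n ih =>
      have : Polynomial.monomial (n + 1) c = Polynomial.monomial n c * Polynomial.X := by
        rw [Polynomial.monomial_mul_X]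
      rw [this, map_mul, Polynomial.aeval_X, ← ih,
        ← comp_mul (hd _) (Real.contDiffAt_log.2 ha.ne')]
      simp only [Polynomial.eval_mul, Polynomial.eval_X]

/-- For Green functions that are polynomial in `log x`, the substitution `x = a(α)` is the
evaluation at the formal logarithm of `a`. -/
lemma evalAt_eq_evalSeries {G : ℝ → ℝ⟦X⟧} {P : (Polynomial ℝ)⟦X⟧}
    (hG : ∀ x > 0, G x = evalLog P (Real.log x)) (ha : 0 < constantCoeff a) :
    evalAt G a = evalSeries (comp Real.log a) P := by
  ext N
  rw [evalAt, coeff_mk, coeff_evalSeries]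
  refine Finset.sum_congr rfl fun n _ => ?_
  rw [← comp_eval_log ha]
  congr 1
  refine comp_congr ?_
  filter_upwards [lt_mem_nhds ha] with x hx
  rw [hG x hx, coeff_evalLog]

end

/-! ### Existence and uniqueness of the shift -/

lemma eq_of_causal {T : ℝ⟦X⟧ → ℝ⟦X⟧}
    (hT : ∀ n a b, X ^ n ∣ a - b → coeff n (T a) = coeff n (T b)) {a b : ℝ⟦X⟧}
    (ha : T a = a) (hb : T b = b) : a = b := by
  ext n
  induction n using Nat.strong_induction_on with
  | _ n ih => rw [← ha, ← hb, hT n a b (X_pow_dvd_sub_iff.2 ih)]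

/-- If `G(α, L) = 1 + c α L + O(α ^ 2)` with `c ≠ 0`, then `G(α, ℓ(α)) = g(α)` has a unique
solution `ℓ` for every `g = 1 + O(α)`: the coefficient of `α ^ (n + 1)` determines that of
`α ^ n` in `ℓ`. -/
lemma existsUnique_evalSeries_eq {P : (Polynomial ℝ)⟦X⟧} {c : ℝ} (hc : c ≠ 0)
    (h0 : coeff 0 P = 1) (h1 : coeff 1 P = Polynomial.C c * Polynomial.X) {g : ℝ⟦X⟧}
    (hg : constantCoeff g = 1) : ∃! ℓ, evalSeries ℓ P = g := by
  set T : ℝ⟦X⟧ → ℝ⟦X⟧ := fun ℓ => PowerSeries.mk fun N => c⁻¹ * (coeff (N + 1) g -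
    ∑ n ∈ Finset.range N, coeff (N + 1 - (n + 2)) (Polynomial.aeval ℓ (coeff (n + 2) P))) with hTdef
  have hT : ∀ n a b, X ^ n ∣ a - b → coeff n (T a) = coeff n (T b) := by
    intro n a b hab
    simp only [hTdef, coeff_mk]
    congr 2
    refine Finset.sum_congr rfl fun k hk => ?_
    have hk' := Finset.mem_range.1 hk
    refine X_pow_dvd_sub_iff.1 (hab.trans ?_) _ (show n + 1 - (k + 2) < n by omega)
    rw [Polynomial.aeval_def, Polynomial.aeval_def, ← Polynomial.eval_map, ← Polynomial.eval_map]
    exact Polynomial.sub_dvd_eval_sub _ _ _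
  have hiff : ∀ ℓ, evalSeries ℓ P = g ↔ T ℓ = ℓ := by
    intro ℓ
    have hcoeff : ∀ N, coeff (N + 1) (evalSeries ℓ P) = c * coeff N ℓ +
        ∑ n ∈ Finset.range N, coeff (N + 1 - (n + 2)) (Polynomial.aeval ℓ (coeff (n + 2) P)) := by
      intro N
      have hC : Polynomial.aeval ℓ (Polynomial.C c * Polynomial.X) = C c * ℓ := by
        rw [map_mul, Polynomial.aeval_X, Polynomial.aeval_C, PowerSeries.algebraMap_apply,
          Algebra.algebraMap_self_apply]
      rw [coeff_evalSeries, Finset.sum_range_succ', Finset.sum_range_succ', h0,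
        show 0 + 1 = 1 from rfl, h1, hC, map_one, Nat.sub_zero, Nat.add_sub_cancel, coeff_C_mul,
        coeff_one, if_neg (Nat.succ_ne_zero N), add_zero, add_comm]
    constructor
    · rintro rfl
      ext N
      simp only [hTdef, coeff_mk, hcoeff, add_sub_cancel_right]
      rw [inv_mul_cancel_left₀ hc]
    · intro h
      ext N
      rcases N with _ | N
      · rw [coeff_evalSeries, coeff_zero_eq_constantCoeff_apply, hg]
        simp [h0]
      · rw [hcoeff]
        have hN := congrArg (coeff N) h
        simp only [hTdef, coeff_mk] at hN
        rw [← hN, mul_inv_cancel_left₀ hc, sub_add_cancel]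
  obtain ⟨ℓ, hℓ⟩ := exists_fixedPoint_of_causal T hT
  exact ⟨ℓ, (hiff ℓ).2 hℓ, fun ℓ' h' => eq_of_causal hT ((hiff ℓ').1 h') hℓ⟩

/-! ### The derivative in the logarithm of the momentum -/

lemma coeff_derivLog (P : (Polynomial ℝ)⟦X⟧) (n : ℕ) :
    coeff n (derivLog P) = (coeff n P).derivative :=
  coeff_mk n _

lemma derivLog_sub (P Q : (Polynomial ℝ)⟦X⟧) :
    derivLog (P - Q) = derivLog P - derivLog Q := by
  ext1 n
  simp only [coeff_derivLog, map_sub]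

lemma derivLog_mul (P Q : (Polynomial ℝ)⟦X⟧) :
    derivLog (P * Q) = derivLog P * Q + P * derivLog Q := by
  ext1 n
  simp only [coeff_derivLog, coeff_mul, map_add, map_sum, Polynomial.derivative_mul,
    Finset.sum_add_distrib]

lemma derivLog_C (q : Polynomial ℝ) : derivLog (C q) = C q.derivative := by
  ext1 n
  rcases n with _ | n
  · simp [coeff_derivLog]
  · simp [coeff_derivLog]

lemma derivLog_map_C (a : ℝ⟦X⟧) : derivLog (PowerSeries.map Polynomial.C a) = 0 := by
  ext1 n
  simp [coeff_derivLog]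

lemma derivLog_X_mul_derivative (P : (Polynomial ℝ)⟦X⟧) :
    derivLog (X * d⁄dX (Polynomial ℝ) P) = X * d⁄dX (Polynomial ℝ) (derivLog P) := by
  ext1 n
  simp [coeff_derivLog, coeff_X_mul_derivative]

lemma X_mul_derivative_map (a : ℝ⟦X⟧) :
    X * d⁄dX (Polynomial ℝ) (PowerSeries.map Polynomial.C a) =
      PowerSeries.map Polynomial.C (X * d⁄dX ℝ a) := by
  ext1 n
  rw [coeff_X_mul_derivative, coeff_map, coeff_map, coeff_X_mul_derivative]
  simp

lemma ext_evalLog {P Q : (Polynomial ℝ)⟦X⟧} (h : ∀ L, evalLog P L = evalLog Q L) : P = Q := by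
  ext1 n
  refine Polynomial.funext fun L => ?_
  rw [← coeff_evalLog, ← coeff_evalLog, h]

/-- `∂G/∂L = γ G` with `γ = O(α)` determines `G` from its value at `L = 0`. -/
lemma eq_zero_of_derivLog_eq {W : (Polynomial ℝ)⟦X⟧} {γ : ℝ⟦X⟧} (hγ : coeff 0 γ = 0)
    (h : derivLog W = PowerSeries.map Polynomial.C γ * W) (h0 : evalLog W 0 = 0) : W = 0 := by
  ext1 n
  induction n using Nat.strong_induction_on with
  | _ n ih =>
    have h1 : (coeff n W).derivative = 0 := by
      rw [← coeff_derivLog, h, coeff_mul]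
      refine Finset.sum_eq_zero fun ij hij => ?_
      have hij' := Finset.HasAntidiagonal.mem_antidiagonal.1 hij
      rcases Nat.eq_zero_or_pos ij.1 with h2 | h2
      · rw [h2, coeff_map, hγ, map_zero, zero_mul]
      · rw [ih ij.2 (by omega)]
        simp
    have h2 := Polynomial.eq_C_of_natDegree_eq_zero
      (Polynomial.derivative_eq_zero.1 h1)
    have h3 := congrArg (coeff n) h0
    rw [coeff_evalLog, h2, Polynomial.eval_C] at h3
    rw [h2, h3]
    simp

/-- For `s = 0` the Green function is `exp(γ(α) L)`, so that `∂ ln G/∂α = γ'(α) L`. -/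
lemma X_mul_derivative_of_derivLog_eq {P : (Polynomial ℝ)⟦X⟧} {γ : ℝ⟦X⟧} (hγ : coeff 0 γ = 0)
    (h : derivLog P = PowerSeries.map Polynomial.C γ * P) (h0 : evalLog P 0 = 1) :
    X * d⁄dX (Polynomial ℝ) P =
      PowerSeries.map Polynomial.C (X * d⁄dX ℝ γ) * C Polynomial.X * P := by
  have h2 : X * d⁄dX (Polynomial ℝ) (derivLog P) =
      PowerSeries.map Polynomial.C (X * d⁄dX ℝ γ) * P +
        PowerSeries.map Polynomial.C γ * (X * d⁄dX (Polynomial ℝ) P) := by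
    rw [h, ← X_mul_derivative_map]
    simp only [Derivation.leibniz, smul_eq_mul]
    ring
  refine sub_eq_zero.1 (eq_zero_of_derivLog_eq hγ ?_ ?_)
  · rw [derivLog_sub, derivLog_X_mul_derivative, derivLog_mul, derivLog_mul, derivLog_map_C,
      derivLog_C, Polynomial.derivative_X, map_one, h2, h]
    ring
  · ext n
    have h1 := congrArg (coeff n) h0
    rw [coeff_evalLog] at h1
    have h3 : ∀ n, (coeff n (PowerSeries.map Polynomial.C (X * d⁄dX ℝ γ) *
        C Polynomial.X * P)).eval 0 = 0 := by
      intro n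
      rw [mul_right_comm, coeff_mul_C]
      simp
    rw [coeff_evalLog, map_sub, Polynomial.eval_sub, h3, coeff_X_mul_derivative,
      Polynomial.eval_mul, h1]
    rcases n with _ | n
    · simp
    · simp [coeff_one]

/-! ### The renormalization group of the physical theory -/

section

variable {s : ℝ} {P Q : (Polynomial ℝ)⟦X⟧}

/-- The infinitesimal form of the evolution law. -/
lemma derivLog_eq_run (h : ∀ L M, evalLog Q (L + M) = run s (evalLog P L) (evalLog Q M)) (M : ℝ) :
    evalLog (derivLog Q) M = run s (evalLog (derivLog P) 0) (evalLog Q M) := by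
  ext n
  have h1 : HasDerivAt (fun L => (coeff n Q).eval (L + M)) ((coeff n Q).derivative.eval M) 0 := by
    have := ((coeff n Q).hasDerivAt (0 + M)).comp_add_const 0 M
    simpa using this
  have h2 : HasDerivAt (fun L => ∑ k ∈ Finset.range (n + 1),
      (coeff k P).eval L * coeff (n - k) (evalLog Q M * fpow (evalLog Q M) s ^ k))
      (∑ k ∈ Finset.range (n + 1), (coeff k P).derivative.eval 0 *
        coeff (n - k) (evalLog Q M * fpow (evalLog Q M) s ^ k)) 0 :=
    HasDerivAt.fun_sum fun k _ => ((coeff k P).hasDerivAt 0).mul_const _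
  have h3 : (fun L => (coeff n Q).eval (L + M)) = fun L => ∑ k ∈ Finset.range (n + 1),
      (coeff k P).eval L * coeff (n - k) (evalLog Q M * fpow (evalLog Q M) s ^ k) := by
    funext L
    rw [← coeff_evalLog, h, coeff_run]
    simp only [coeff_evalLog]
  rw [h3] at h1
  rw [coeff_evalLog, coeff_derivLog, h1.unique h2, coeff_run]
  simp only [coeff_evalLog, coeff_derivLog]

/-- The renormalization group equation of two schemes, evaluated at the shift `ℓ = ln δ` that
relates them. -/
lemma anomalous_dimension_relation {γ γh ℓ : ℝ⟦X⟧} {Ph : (Polynomial ℝ)⟦X⟧}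
    (hP0 : coeff 0 P = 1) (hγh : γh ≠ 0)
    (hrg : derivLog P = PowerSeries.map Polynomial.C γ * P +
      PowerSeries.map Polynomial.C (C s * γ) * (X * d⁄dX (Polynomial ℝ) P))
    (hrgh : evalLog (derivLog Ph) 0 = γh * evalLog Ph 0 +
      C s * γh * (X * d⁄dX ℝ (evalLog Ph 0)))
    (hPP : ∀ L M, evalLog P (L + M) = run s (evalLog P L) (evalLog P M))
    (hPPh : ∀ L M, evalLog Ph (L + M) = run s (evalLog P L) (evalLog Ph M))
    (hPh0 : constantCoeff (evalLog Ph 0) = 1)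
    (hℓ : evalSeries ℓ P = evalLog Ph 0) :
    C s * X * d⁄dX ℝ ℓ * γ * γh = γ - γh := by
  set g := evalLog Ph 0 with hg
  set H := evalSeries ℓ (derivLog P) with hH
  have hH1 : H = evalLog (derivLog Ph) 0 := by
    rw [hH, evalSeries_eq_run hP0 (derivLog_eq_run hPP), derivLog_eq_run hPPh, hℓ]
  have hH2 : H = γh * (g + C s * (X * d⁄dX ℝ g)) := by
    rw [hH1, hrgh]; ring
  have hH3 : H = γ * g + C s * γ * evalSeries ℓ (X * d⁄dX (Polynomial ℝ) P) := by
    rw [hH, hrg, map_add, map_mul, map_mul, evalSeries_map_C, evalSeries_map_C, hℓ]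
  have hH4 := X_mul_derivative_evalSeries ℓ P
  rw [hℓ, ← hH] at hH4
  have hH0 : H ≠ 0 := by
    rw [hH2]
    refine mul_ne_zero hγh fun h => ?_
    have := congrArg constantCoeff h
    simp [hPh0] at this
  refine mul_right_cancel₀ hH0 ?_
  linear_combination (-γ) * hH2 + γh * hH3 - C s * γ * γh * hH4

end

lemma coe_ne_zero_of_ne_zero {a : ℝ⟦X⟧} (ha : a ≠ 0) : (a : ℝ⸨X⸩) ≠ 0 := fun h =>
  ha (HahnSeries.ofPowerSeries_injective (h.trans (map_zero _).symm))

lemma laurent_identity {s : ℝ} (hs : s ≠ 0) {t γ γh : ℝ⟦X⟧} (hγ : γ ≠ 0) (hγh : γh ≠ 0)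
    (h : C s * X * t * γ * γh = γ - γh) :
    (t : ℝ⸨X⸩) = ((C s * X : ℝ⟦X⟧) : ℝ⸨X⸩)⁻¹ * ((γh : ℝ⸨X⸩)⁻¹ - (γ : ℝ⸨X⸩)⁻¹) ∧
      (t : ℝ⸨X⸩) = ((γ - γh : ℝ⟦X⟧) : ℝ⸨X⸩) / ((C s * X * γh * γ : ℝ⟦X⟧) : ℝ⸨X⸩) := by
  have hX : (C s * X : ℝ⟦X⟧) ≠ 0 := by
    refine mul_ne_zero (fun h => hs ?_) X_ne_zero
    simpa using congrArg constantCoeff h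
  have h1 := coe_ne_zero_of_ne_zero hX
  have h2 := coe_ne_zero_of_ne_zero hγ
  have h3 := coe_ne_zero_of_ne_zero hγh
  have h4 := congrArg (fun a : ℝ⟦X⟧ => (a : ℝ⸨X⸩)) h
  simp only [PowerSeries.coe_mul, PowerSeries.coe_sub] at h1 h4 ⊢
  refine ⟨?_, ?_⟩
  · rw [eq_inv_mul_iff_mul_eq₀ h1, inv_sub_inv h3 h2, eq_div_iff (mul_ne_zero h3 h2)]
    linear_combination h4
  · rw [eq_div_iff (mul_ne_zero (mul_ne_zero h1 h3) h2)]
    linear_combination h4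

end DysonSchwinger

theorem mainTheorem1 (K : ℝ → ℝ → ℝ → ℝ) (f : ℕ → ℤ → ℝ)
    (hK : DysonSchwinger.IsPropagatorKernel K f) (s : ℝ)
    (G Gh : ℝ → ℝ⟦X⟧) (γ γh : ℝ⟦X⟧)
    (hG : DysonSchwinger.IsMOMSolution K s G γ)
    (hGh : DysonSchwinger.IsMSSolution K s Gh γh)
    (hγ : coeff 1 γ ≠ 0) (hγh : coeff 1 γh ≠ 0) :
    ∃ δ : ℝ⟦X⟧,
      DysonSchwinger.IsShift G Gh δ ∧
      (∀ δ' : ℝ⟦X⟧, DysonSchwinger.IsShift G Gh δ' → δ' = δ) ∧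
      f 0 (-1) ≠ 0 ∧
      Real.log (constantCoeff δ) = -(f 0 0) / f 0 (-1) ∧
      (s ≠ 0 →
        ((d⁄dX ℝ (DysonSchwinger.comp Real.log δ) : ℝ⟦X⟧) : ℝ⸨X⸩) =
            ((C s * X : ℝ⟦X⟧) : ℝ⸨X⸩)⁻¹ * ((γh : ℝ⸨X⸩)⁻¹ - (γ : ℝ⸨X⸩)⁻¹) ∧
        ((d⁄dX ℝ (DysonSchwinger.comp Real.log δ) : ℝ⟦X⟧) : ℝ⸨X⸩) =
            ((γ - γh : ℝ⟦X⟧) : ℝ⸨X⸩) / ((C s * X * γh * γ : ℝ⟦X⟧) : ℝ⸨X⸩)) ∧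
      (s = 0 →
        γh = γ ∧
        γ * DysonSchwinger.comp Real.log δ = DysonSchwinger.comp Real.log (Gh 1)) := by
  open DysonSchwinger in
  obtain ⟨Z, Gr, hsol, hMOM, hlim⟩ := hG
  obtain ⟨Zh, Grh, hsolh, hMS, hlimh⟩ := hGh
  obtain ⟨P, hGP, hrg⟩ := hlim.exists_log_expansion hK hsol
  obtain ⟨Ph, hGPh, hrgh⟩ := hlimh.exists_log_expansion hK hsolh
  have hlog : ∀ L, G (Real.exp L) = evalLog P L := fun L => by
    rw [hGP _ (Real.exp_pos L), Real.log_exp]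
  have hlogh : ∀ L, Gh (Real.exp L) = evalLog Ph L := fun L => by
    rw [hGPh _ (Real.exp_pos L), Real.log_exp]
  have hG1 : G 1 = 1 := hMOM.green_one hlim
  have hPone : evalLog P 0 = 1 := by rw [← hlog, Real.exp_zero, hG1]
  have hPhone : evalLog Ph 0 = Gh 1 := by rw [← hlogh, Real.exp_zero]
  have hGh1 : constantCoeff (Gh 1) = 1 := hlimh.constantCoeff_green hK hsolh one_pos
  -- evolution of both solutions by the kinematically renormalized one
  have hPP : ∀ L M, evalLog P (L + M) = run s (evalLog P L) (evalLog P M) := fun L M => by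
    rw [← hlog, ← hlog, ← hlog, Real.exp_add,
      green_mul_eq_run hK hsol hMOM hlim hsol hlim (Real.exp_pos L) (Real.exp_pos M)]
  have hPPh : ∀ L M, evalLog Ph (L + M) = run s (evalLog P L) (evalLog Ph M) := fun L M => by
    rw [← hlogh, ← hlog, ← hlogh, Real.exp_add,
      green_mul_eq_run hK hsol hMOM hlim hsolh hlimh (Real.exp_pos L) (Real.exp_pos M)]
  -- the renormalization group equation over `ℝ[L]`
  have hrgP : derivLog P = PowerSeries.map Polynomial.C γ * P +
      PowerSeries.map Polynomial.C (C s * γ) * (X * d⁄dX (Polynomial ℝ) P) := by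
    refine ext_evalLog fun L => ?_
    have h1 := hrg _ (Real.exp_pos L)
    rw [Real.log_exp, hlog] at h1
    have hmap : ∀ a : ℝ⟦X⟧, evalLog (PowerSeries.map Polynomial.C a) L = a := fun a => by
      ext n; simp [coeff_evalLog]
    have hder : evalLog (X * d⁄dX (Polynomial ℝ) P) L = X * d⁄dX ℝ (evalLog P L) := by
      ext n; simp [coeff_evalLog, coeff_X_mul_derivative]
    have hadd : ∀ A B, evalLog (A + B) L = evalLog A L + evalLog B L := fun A B => map_add _ A B
    have hmul : ∀ A B, evalLog (A * B) L = evalLog A L * evalLog B L := fun A B => map_mul _ A B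
    rw [h1, hadd, hmul, hmul, hmap, hmap, hder]
  have hP0 : coeff 0 P = 1 := by
    refine Polynomial.funext fun L => ?_
    rw [← coeff_evalLog, ← hlog, coeff_zero_eq_constantCoeff_apply,
      hlim.constantCoeff_green hK hsol (Real.exp_pos L), Polynomial.eval_one]
  have hγ0 : coeff 0 γ = 0 := by
    have h1 := congrArg (coeff 0) hrgP
    rw [coeff_derivLog, hP0] at h1
    simp only [map_add, coeff_zero_eq_constantCoeff_apply, map_mul, constantCoeff_X, zero_mul,
      mul_zero, add_zero, Polynomial.derivative_one] at h1
    rw [← coeff_zero_eq_constantCoeff_apply, ← coeff_zero_eq_constantCoeff_apply, hP0, mul_one,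
      coeff_map] at h1
    exact (Polynomial.C_eq_zero.1 h1.symm)
  -- the first order of the renormalization group equation
  have hP1 : coeff 1 P = Polynomial.C (coeff 1 γ) * Polynomial.X := by
    have h1 : (coeff 1 P).derivative = Polynomial.C (coeff 1 γ) := by
      have h2 := congrArg (coeff 1) hrgP
      rw [coeff_derivLog] at h2
      rw [h2, map_add, coeff_mul, coeff_mul, Finset.Nat.sum_antidiagonal_eq_sum_range_succ_mk,
        Finset.sum_range_succ, Finset.sum_range_one,
        Finset.Nat.sum_antidiagonal_eq_sum_range_succ_mk, Finset.sum_range_succ,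
        Finset.sum_range_one]
      simp only [Nat.sub_zero, Nat.sub_self, coeff_X_mul_derivative, coeff_map, hP0, hγ0,
        coeff_C_mul]
      simp
    have h2 : (coeff 1 P - Polynomial.C (coeff 1 γ) * Polynomial.X).derivative = 0 := by
      simp [h1]
    have h3 := Polynomial.eq_C_of_natDegree_eq_zero
      (Polynomial.derivative_eq_zero.1 h2)
    have h4 := congrArg (Polynomial.eval 0) h3
    have h5 : (coeff 1 P).eval 0 = 0 := by
      rw [← coeff_evalLog, hPone]; simp [coeff_one]
    rw [Polynomial.eval_sub, h5, Polynomial.eval_C] at h4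
    rw [← h4] at h3
    simpa [sub_eq_zero] using h3
  obtain ⟨ℓ, hℓ, hℓuniq⟩ := existsUnique_evalSeries_eq hγ hP0 hP1 hGh1
  obtain ⟨δ, hδ0, hδ⟩ := exists_comp_log_eq ℓ
  have hf : coeff 1 γ = -f 0 (-1) := coeff_one_anomalous_of_MOM hK hsol hMOM hlim
  have hγ' : γ ≠ 0 := fun h => hγ (by rw [h, map_zero])
  have hγh' : γh ≠ 0 := fun h => hγh (by rw [h, map_zero])
  have hrel : C s * X * d⁄dX ℝ ℓ * γ * γh = γ - γh := by
    refine anomalous_dimension_relation hP0 hγh' hrgP ?_ hPP hPPh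
      (by rw [hPhone, hGh1]) (by rw [hℓ, hPhone])
    have h1 := hrgh 1 one_pos
    rwa [Real.log_one, ← hPhone] at h1
  refine ⟨δ, ⟨hδ0, fun x hx => ?_⟩, fun δ' hδ' => ?_, ?_, ?_, fun hs => ?_, ?_⟩
  · rw [evalAt_eq_evalSeries hGP (by simpa using mul_pos hx hδ0), comp_log_C_mul hx hδ0, hδ,
      ← evalSeries_shift, evalSeries_eq_run (c := evalLog P (Real.log x)) (s := s) hP0 ?_ ℓ, hℓ,
      ← hGP x hx, ← green_mul_eq_run hK hsol hMOM hlim hsolh hlimh hx one_pos, mul_one]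
    intro M
    rw [← hPP, add_comm]
    ext n
    simp [coeff_evalLog]
  · refine comp_log_injective hδ'.1 hδ0 ?_
    rw [hδ]
    refine hℓuniq _ ?_
    have h1 := hδ'.2 1 one_pos
    rwa [map_one, one_mul, evalAt_eq_evalSeries hGP hδ'.1] at h1
  · intro h
    rw [h, neg_zero] at hf
    exact hγ hf
  · have h1 := congrArg (coeff 1) hℓ
    rw [coeff_one_green_of_MS hK hsolh hMS hlimh, coeff_evalSeries, Finset.sum_range_succ,
      Finset.sum_range_one, hP0, hP1, hf] at h1
    have h2 : Real.log (constantCoeff δ) = constantCoeff ℓ := by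
      rw [← hδ, constantCoeff_comp]
    rw [hf] at hγ
    have h3 : f 0 (-1) ≠ 0 := fun h => hγ (by rw [h, neg_zero])
    rw [h2, eq_div_iff h3]
    simp [coeff_one, Polynomial.aeval_C] at h1
    linarith
  · rw [hδ]
    exact laurent_identity hs hγ' hγh' hrel
  · rintro rfl
    rw [map_zero] at hrel hrgP
    have hγγ : γh = γ := by
      have : γ - γh = 0 := by rw [← hrel]; ring
      exact (sub_eq_zero.1 this).symm
    refine ⟨hγγ, ?_⟩
    rw [hδ]
    have hexp : derivLog P = PowerSeries.map Polynomial.C γ * P := by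
      rw [hrgP]; simp
    symm
    refine comp_log_eq_of_mul_derivative (by rw [hGh1]; exact one_pos) ?_ ?_
    · rw [hGh1, Real.log_one, map_mul, ← coeff_zero_eq_constantCoeff_apply, hγ0, zero_mul]
    · have h1 := X_mul_derivative_evalSeries ℓ P
      rw [X_mul_derivative_of_derivLog_eq hγ0 hexp hPone, hexp,
        map_mul (evalSeries ℓ), map_mul (evalSeries ℓ), map_mul (evalSeries ℓ),
        evalSeries_map_C, evalSeries_map_C, evalSeries_C, Polynomial.aeval_X, hℓ] at h1
      refine mul_left_cancel₀ (X_ne_zero (R := ℝ)) ?_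
      simp only [Derivation.leibniz, smul_eq_mul]
      linear_combination -h1
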